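/- Let $N$ be a prime. For a positive real $u$, a function $\mathrm{tr}:\mathcal D\times\mathcal M\to\mathbb Z_N$ with $\mathcal D$ finite is called $u$-uniform if $|\{d\in\mathcal D:\mathrm{tr}(d,m)=j\}|\le|\mathcal D|/u$ for all $m\in\mathcal M$, $j\in\mathbb Z_N$. In the DDH game in the generic group model of order $N$, a uniformly random permutation $\sigma$ of $\mathbb Z_N$ and, independently, a uniformly random secret $d=(d_1,d_2,d_3,k)\in\mathbb Z_N^3\times\{0,1\}$ are chosen. An algorithm may make inner queries $i\in\mathbb Z_N$, answered by $\sigma(i)$, and outer queries $m=(a_1,a_2,a_3,b)\in\mathbb Z_N^4$ with $(a_1,a_2,a_3)\ne(0,0,0)$, answered by $\sigma(\mathrm{tr}(d,m))$, where $$\mathrm{tr}(d,m)=\begin{cases}a_1d_1+a_2d_2+a_3d_3+b & \text{if } k=0,\\ a_1d_1+a_2d_2+a_3d_1d_2+b & \text{if } k=1;\end{cases}$$ it succeeds if it outputs $k$. In the sqDDH game the secret is a uniformly random $d=(d_1,d_2,k)\in\mathbb Z_N^2\times\{0,1\}$, outer queries are $m=(a_1,a_2,b)\in\mathbb Z_N^3$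 with $(a_1,a_2)\ne(0,0)$, and $\mathrm{tr}(d,m)=a_1d_1+a_2d_2+b$ if $k=0$, $\mathrm{tr}(d,m)=a_1d_1+a_2d_1^2+b$ if $k=1$. The algorithms receive no other input: the encodings of the generator and of the challenge elements are obtained through queries, and count as such. A non-preprocessing, non-adaptive algorithm making at most $T$ queries fixes at most $T$ (inner or outer) queries in advance and outputs a bit depending on the answers. A non-adaptive $(S,T)$ algorithm with preprocessing is a pair $A=(A_0,A_1)$, where $A_0$ maps $\sigma$ to an advice string $z\in\{0,1\}^S$, and $A_1$, given $z$, fixes at most $T$ queries depending only on $z$, and outputs a bit depending on $z$ and the answers. Algorithms may be randomized ($A_0$ and $A_1$ may share their randomness, which is independent of $\sigma$ and $d$), and success probabilities are taken over $\sigma$, $d$ and the randomness of the algorithm. **Theorem.** Consider either the DDH or the sqDDH game, let $S,T\ge 0$ be integers, and let $\mathrm{MaxS}(T)$ be the optimal success probability in this game of a non-preprocessing, non-adaptive algorithm that makes at most $T$ queries. Then $\mathrm{tr}$ is $(N/2)$-uniform, and the success probability of every non-adaptive $(S,T)$ algorithm with preprocessing is at most $$\mathrm{MaxS}(T)+\sqrt{\frac{2\ln(2)\,ST}{N}}+\frac{T^2}{N}\;\le\;\frac12+\frac{2T^2}{N}+\sqrt{\frac{2\ln(2)\,ST}{N}}.$$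 -/

import Mathlib

/-- A permutation challenge game on `ZMod N`, with inner permutation `σ : ZMod N → ZMod N` and a
secret drawn uniformly from a finite space.  An outer query `m` is translated with the secret `d`
to the position `tr d m` of `σ`, and the answer is post-processed by `post d`.  The predicate
`suc d v` decides whether the output `v` of an adversary is correct for the secret `d`. -/
structure PCGame (N : ℕ) where
  Secret : Type
  secretFintype : Fintype Secret
  OuterQuery : Type
  Output : Type
  tr : Secret → OuterQuery → ZMod N
  post : Secret → ZMod N → ZMod N
  suc : Secret → Output → Bool

attribute [instance] PCGame.secretFintype

namespace PCGame

/-- The translation function is `u`-uniform. -/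
def IsUniform {N : ℕ} (G : PCGame N) (u : ℝ) : Prop :=
  ∀ (m : G.OuterQuery) (j : ZMod N),
    ((Finset.univ.filter fun d : G.Secret => G.tr d m = j).card : ℝ) ≤
      (Fintype.card G.Secret : ℝ) / u

/-- An oracle query is either an inner query (to `σ` itself) or an outer query. -/
abbrev Query {N : ℕ} (G : PCGame N) : Type := ZMod N ⊕ G.OuterQuery

/-- The answer of the oracle with inner permutation `σ` and secret `d`. -/
def answer {N : ℕ} (G : PCGame N) (σ : Equiv.Perm (ZMod N)) (d : G.Secret) :
    G.Query → ZMod N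
  | Sum.inl i => σ i
  | Sum.inr m => G.post d (σ (G.tr d m))

/-- A deterministic non-adaptive online algorithm making at most `T` queries: the queries are
fixed in advance, and the output is an arbitrary function of the vector of answers. -/
structure OnlineAlg {N : ℕ} (G : PCGame N) (T : ℕ) where
  numQueries : ℕ
  numQueries_le : numQueries ≤ T
  query : Fin numQueries → G.Query
  output : (Fin numQueries → ZMod N) → G.Output

/-- Whether the online algorithm succeeds against the permutation `σ` and the secret `d`. -/
def OnlineAlg.succeeds {N : ℕ} {G : PCGame N} {T : ℕ} (A : G.OnlineAlg T)
    (σ : Equiv.Perm (ZMod N)) (d : G.Secret) : Bool :=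
  G.suc d (A.output fun i => G.answer σ d (A.query i))

/-- A deterministic non-adaptive `(S, T)`-algorithm with preprocessing: the preprocessing
algorithm sees all of `σ` and outputs `S` bits of advice; given the advice, the online algorithm
is non-adaptive (its queries and its output function may depend on the advice). -/
structure PreprocAlg {N : ℕ} (G : PCGame N) (S T : ℕ) where
  advice : Equiv.Perm (ZMod N) → (Fin S → Bool)
  online : (Fin S → Bool) → G.OnlineAlg T

/-- Success probability, over a uniform permutation `σ` and an independent uniform secret, of the
deterministic algorithm that runs the online algorithm `A σ`. -/
noncomputable def winProb {N : ℕ} [NeZero N] (G : PCGame N) {T : ℕ}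
    (A : Equiv.Perm (ZMod N) → G.OnlineAlg T) : ℝ :=
  (∑ σ : Equiv.Perm (ZMod N), ∑ d : G.Secret, if (A σ).succeeds σ d then (1 : ℝ) else 0) /
    ((Fintype.card (Equiv.Perm (ZMod N)) : ℝ) * (Fintype.card G.Secret : ℝ))

/-- Success probability of a randomized non-preprocessing non-adaptive algorithm.  A randomized
algorithm is a probability distribution over deterministic ones. -/
noncomputable def onlineSuccess {N : ℕ} [NeZero N] (G : PCGame N) {T : ℕ}
    (μ : PMF (G.OnlineAlg T)) : ℝ :=
  ∑' A : G.OnlineAlg T, (μ A).toReal * G.winProb fun _ => A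

/-- Success probability of a randomized non-adaptive algorithm with preprocessing.  The
preprocessing and the online algorithm share the random tape, which is independent of the
permutation and of the secret. -/
noncomputable def preprocSuccess {N : ℕ} [NeZero N] (G : PCGame N) {S T : ℕ}
    (μ : PMF (G.PreprocAlg S T)) : ℝ :=
  ∑' A : G.PreprocAlg S T, (μ A).toReal * G.winProb fun σ => A.online (A.advice σ)

/-- The optimal success probability of a non-preprocessing, non-adaptive algorithm that makes at
most `T` queries. -/
noncomputable def MaxS {N : ℕ} [NeZero N] (G : PCGame N) (T : ℕ) : ℝ :=
  ⨆ μ : PMF (G.OnlineAlg T), G.onlineSuccess μ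

end PCGame

/-- The DDH game in the generic group `ZMod N`.  The secret is `(d₁, d₂, d₃, k)` and the adversary
has to output the bit `k`.  The outer query `(a₁, a₂, a₃, b)`, with `a₁, a₂, a₃` not all zero, is
answered by the encoding of `a₁ d₁ + a₂ d₂ + a₃ c + b`, where `c = d₃` if `k = 0` and `c = d₁ d₂`
if `k = 1`. -/
def ddhGame (N : ℕ) [NeZero N] : PCGame N where
  Secret := ZMod N × ZMod N × ZMod N × Bool
  secretFintype := inferInstance
  OuterQuery := {q : ZMod N × ZMod N × ZMod N × ZMod N //
    ¬ (q.1 = 0 ∧ q.2.1 = 0 ∧ q.2.2.1 = 0)}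
  Output := Bool
  tr := fun d m => match d, m with
    | (d₁, d₂, d₃, false), ⟨(a₁, a₂, a₃, b), _⟩ => a₁ * d₁ + a₂ * d₂ + a₃ * d₃ + b
    | (d₁, d₂, _, true), ⟨(a₁, a₂, a₃, b), _⟩ => a₁ * d₁ + a₂ * d₂ + a₃ * (d₁ * d₂) + b
  post := fun _ j => j
  suc := fun d v => v == d.2.2.2

/-- The square-DDH game in the generic group `ZMod N`.  The secret is `(d₁, d₂, k)` and the
adversary has to output the bit `k`.  The outer query `(a₁, a₂, b)`, with `a₁, a₂` not both zero,
is answered by the encoding of `a₁ d₁ + a₂ c + b`, where `c = d₂` if `k = 0` and `c = d₁ ^ 2` if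
`k = 1`. -/
def sqddhGame (N : ℕ) [NeZero N] : PCGame N where
  Secret := ZMod N × ZMod N × Bool
  secretFintype := inferInstance
  OuterQuery := {q : ZMod N × ZMod N × ZMod N // ¬ (q.1 = 0 ∧ q.2.1 = 0)}
  Output := Bool
  tr := fun d m => match d, m with
    | (d₁, d₂, false), ⟨(a₁, a₂, b), _⟩ => a₁ * d₁ + a₂ * d₂ + b
    | (d₁, _, true), ⟨(a₁, a₂, b), _⟩ => a₁ * d₁ + a₂ * d₁ ^ 2 + b
  post := fun _ j => j
  suc := fun d v => v == d.2.2

/-! ### Averaging over stabilisers and entropy on the symmetric group. -/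

section PermEntropy

open Equiv Finset

variable {α : Type*} [Fintype α] [DecidableEq α]

/-! Fix an advice string and let F(σ) be the success probability over the secret alone of the online
algorithm that it selects. The advice can do no better than pick the largest of the `2 ^ S`
functions F at σ, so it suffices to bound the exponential moments of each F (`sum_exp_avg_le`), sum
over the strings (`sum_select_le`) and optimise the exponent (`le_add_sqrt_of_forall_exponent`).

F is an average over secrets d of indicators that depend on σ only through its values on a set Q d:
the inner positions I together with the translated outer positions. Tilt the uniform distribution by
`exp (l * F)`. For each d, Hoeffding's lemma bounds the change in the mean of the d-th indicator,
when passing from the marginal on I to the marginal on Q d, by the relative entropy of these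
marginals. The average of these relative entropies is at most c times the full entropy relative to
I, by a Shearer-type inequality on the symmetric group (`sum_negEnt_fixAvg_le`). Here c = 4T/N: by
uniformity an outer query hits a given point for a fraction at most 2/N of the secrets, there are at
most T queries, and pairs of points matter because a transposition moves two. Inner positions are
queried for every secret, so they are kept out of the count by conditioning on I. The conditioning
costs nothing: an algorithm without advice can relabel its answers to simulate any values on I
(`OnlineAlg.fixAvg_win_le`).

The Shearer-type inequality follows from a variational argument. At a maximiser of the difference of
its two sides, a small step along the random transposition walk outside I must not increase that
difference. The derivative of entropy is a swap energy, and the energies of the averages over Q d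
add up to at most c times the full energy, so the energy of the maximiser vanishes and the maximiser
depends on the values on I only, where both sides agree.

For the explicit bound on `MaxS`: unless two queries collide that do not always collide, the answers
have the same law for all secrets. Each such collision has probability at most 2/N, since the
difference of two outer queries is constant or again an outer query. Hence the preprocessing bound
already holds without the summand T²/N. -/

/-- The permutations that fix every point of `Q`. -/
def pointFixer (Q : Finset α) : Finset (Perm α) :=
  Finset.univ.filter fun h => ∀ q ∈ Q, h q = q

/-- The average of `f` over the permutations that agree with the given one on `Q`. -/
noncomputable def fixAvg (Q : Finset α) (f : Perm α → ℝ) (σ : Perm α) : ℝ :=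
  (∑ h ∈ pointFixer Q, f (σ * h)) / ((pointFixer Q).card : ℝ)

/-- The negative entropy of a function on permutations. -/
noncomputable def negEnt (f : Perm α → ℝ) : ℝ := ∑ σ, f σ * Real.log (f σ)

/-- The symmetric relative entropy density. -/
noncomputable def symKL (a b : ℝ) : ℝ := (a - b) * (Real.log a - Real.log b)

/-- The entropy dissipation along the transpositions in `S`. -/
noncomputable def swapEnergy (S : Finset (α × α)) (f : Perm α → ℝ) : ℝ :=
  ∑ x ∈ S, ∑ σ : Perm α, symKL (f σ) (f (σ * swap x.1 x.2))

/-- The generator of the walk along the transpositions in `S`. -/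
def swapGen (S : Finset (α × α)) (f : Perm α → ℝ) (σ : Perm α) : ℝ :=
  ∑ x ∈ S, (f (σ * swap x.1 x.2) - f σ)

theorem mem_pointFixer {Q : Finset α} {h : Perm α} :
    h ∈ pointFixer Q ↔ ∀ q ∈ Q, h q = q := by simp [pointFixer]

theorem one_mem_pointFixer (Q : Finset α) : (1 : Perm α) ∈ pointFixer Q := by
  simp [mem_pointFixer]

theorem mul_mem_pointFixer {Q : Finset α} {g h : Perm α} (hg : g ∈ pointFixer Q)
    (hh : h ∈ pointFixer Q) : g * h ∈ pointFixer Q := by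
  rw [mem_pointFixer] at *
  intro q hq
  rw [Perm.mul_apply, hh q hq, hg q hq]

theorem inv_mem_pointFixer {Q : Finset α} {g : Perm α} (hg : g ∈ pointFixer Q) :
    g⁻¹ ∈ pointFixer Q := by
  rw [mem_pointFixer] at *
  intro q hq
  rw [Perm.inv_eq_iff_eq, hg q hq]

theorem pointFixer_anti {I Q : Finset α} (h : I ⊆ Q) : pointFixer Q ⊆ pointFixer I := by
  intro g hg
  rw [mem_pointFixer] at *
  exact fun q hq => hg q (h hq)

theorem card_pointFixer_pos (Q : Finset α) : (0 : ℝ) < (pointFixer Q).card := by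
  exact_mod_cast Finset.card_pos.mpr ⟨1, one_mem_pointFixer Q⟩

theorem apply_mem_iff_of_mem_pointFixer {Q : Finset α} {g : Perm α} (hg : g ∈ pointFixer Q)
    (i : α) : g i ∈ Q ↔ i ∈ Q := by
  rw [mem_pointFixer] at hg
  constructor
  · intro h
    have := hg _ h
    rwa [g.injective this] at h
  · intro h
    rwa [hg i h]

theorem sum_mul_right_perm (f : Perm α → ℝ) (h : Perm α) : ∑ σ, f (σ * h) = ∑ σ, f σ :=
  Fintype.sum_equiv (Equiv.mulRight h) _ _ fun _ => rfl

theorem sum_pointFixer_mul_left {Q : Finset α} {g : Perm α} (hg : g ∈ pointFixer Q)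
    (f : Perm α → ℝ) : ∑ h ∈ pointFixer Q, f (g * h) = ∑ h ∈ pointFixer Q, f h := by
  refine Finset.sum_nbij' (fun h => g * h) (fun h => g⁻¹ * h) ?_ ?_ ?_ ?_ ?_
  · exact fun h hh => mul_mem_pointFixer hg hh
  · exact fun h hh => mul_mem_pointFixer (inv_mem_pointFixer hg) hh
  · simp
  · simp
  · simp

theorem fixAvg_mul_right {Q : Finset α} {g : Perm α} (hg : g ∈ pointFixer Q)
    (f : Perm α → ℝ) (σ : Perm α) : fixAvg Q f (σ * g) = fixAvg Q f σ := by
  unfold fixAvg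
  rw [← sum_pointFixer_mul_left hg (fun h => f (σ * h))]
  simp [mul_assoc]

theorem fixAvg_of_invariant {Q : Finset α} {f : Perm α → ℝ}
    (hf : ∀ h ∈ pointFixer Q, ∀ σ, f (σ * h) = f σ) : fixAvg Q f = f := by
  funext σ
  unfold fixAvg
  rw [Finset.sum_congr rfl fun h hh => hf h hh σ, Finset.sum_const, nsmul_eq_mul]
  exact mul_div_cancel_left₀ _ (card_pointFixer_pos Q).ne'

/-- Averaging is the conditional expectation given the values on `Q`, so it can be dropped against a
test function that depends on those values only. -/
theorem sum_fixAvg_mul {Q : Finset α} (f : Perm α → ℝ) {φ : Perm α → ℝ}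
    (hφ : ∀ h ∈ pointFixer Q, ∀ σ, φ (σ * h) = φ σ) :
    ∑ σ, fixAvg Q f σ * φ σ = ∑ σ, f σ * φ σ := by
  have key : ∑ σ, fixAvg Q f σ * φ σ
      = (∑ h ∈ pointFixer Q, ∑ σ, f (σ * h) * φ (σ * h)) / ((pointFixer Q).card : ℝ) := by
    rw [Finset.sum_comm, Finset.sum_div]
    refine Finset.sum_congr rfl fun σ _ => ?_
    rw [fixAvg, div_mul_eq_mul_div, Finset.sum_mul]
    congr 1
    exact Finset.sum_congr rfl fun h hh => by rw [hφ h hh]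
  rw [key, Finset.sum_congr rfl fun h _ => sum_mul_right_perm (fun σ => f σ * φ σ) h,
    Finset.sum_const, nsmul_eq_mul]
  exact mul_div_cancel_left₀ _ (card_pointFixer_pos Q).ne'

theorem sum_fixAvg (Q : Finset α) (f : Perm α → ℝ) : ∑ σ, fixAvg Q f σ = ∑ σ, f σ := by
  simpa using sum_fixAvg_mul (Q := Q) f (φ := fun _ => 1) (fun _ _ _ => rfl)

theorem fixAvg_pos {Q : Finset α} {f : Perm α → ℝ} (hf : ∀ σ, 0 < f σ) (σ : Perm α) :
    0 < fixAvg Q f σ :=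
  div_pos (Finset.sum_pos (fun _ _ => hf _) ⟨1, one_mem_pointFixer Q⟩) (card_pointFixer_pos Q)

theorem fixAvg_add_mul (Q : Finset α) (f g : Perm α → ℝ) (ε : ℝ) (σ : Perm α) :
    fixAvg Q (fun τ => f τ + ε * g τ) σ = fixAvg Q f σ + ε * fixAvg Q g σ := by
  unfold fixAvg
  rw [Finset.sum_add_distrib, ← Finset.mul_sum]
  ring

theorem continuous_fixAvg (Q : Finset α) (σ : Perm α) :
    Continuous fun f : Perm α → ℝ => fixAvg Q f σ := by
  unfold fixAvg
  fun_prop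

theorem continuous_negEnt : Continuous (negEnt : (Perm α → ℝ) → ℝ) := by
  unfold negEnt
  refine continuous_finsetSum _ fun σ _ => ?_
  exact Real.continuous_mul_log.comp (continuous_apply σ)

/-- The logarithm of the coarser average is invariant under both stabilisers, so it integrates
equally against both averages. This turns an entropy difference into the relative entropy that
change of measure needs. -/
theorem negEnt_sub_negEnt_fixAvg {I Q : Finset α} (hIQ : I ⊆ Q) (f : Perm α → ℝ) :
    negEnt (fixAvg Q f) - negEnt (fixAvg I f) =
      ∑ σ, fixAvg Q f σ * (Real.log (fixAvg Q f σ) - Real.log (fixAvg I f σ)) := by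
  have inv : ∀ h ∈ pointFixer I, ∀ σ,
      Real.log (fixAvg I f (σ * h)) = Real.log (fixAvg I f σ) :=
    fun h hh σ => by rw [fixAvg_mul_right hh]
  have h1 := sum_fixAvg_mul (Q := I) f (φ := fun σ => Real.log (fixAvg I f σ)) inv
  have h2 := sum_fixAvg_mul (Q := Q) f (φ := fun σ => Real.log (fixAvg I f σ))
    fun h hh => inv h (pointFixer_anti hIQ hh)
  simp only [mul_sub, Finset.sum_sub_distrib, negEnt]
  rw [h2, ← h1]

/-- Sum the bound `log x ≤ x - 1` at `x = b i * A / (a i * B)` with weights `a i`; the linear terms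
cancel. -/
theorem log_sum_inequality {ι : Type*} {s : Finset ι} (hs : s.Nonempty) {a b : ι → ℝ}
    (ha : ∀ i ∈ s, 0 < a i) (hb : ∀ i ∈ s, 0 < b i) :
    (∑ i ∈ s, a i) * (Real.log (∑ i ∈ s, a i) - Real.log (∑ i ∈ s, b i)) ≤
      ∑ i ∈ s, a i * (Real.log (a i) - Real.log (b i)) := by
  set A := ∑ i ∈ s, a i with hA
  set B := ∑ i ∈ s, b i with hB
  have hA0 : 0 < A := Finset.sum_pos ha hs
  have hB0 : 0 < B := Finset.sum_pos hb hs
  have key : ∀ i ∈ s, a i * (Real.log A - Real.log B) + a i - b i * (A / B) ≤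
      a i * (Real.log (a i) - Real.log (b i)) := by
    intro i hi
    have h1 := Real.log_le_sub_one_of_pos
      (show 0 < (b i * A) / (a i * B) from
        div_pos (mul_pos (hb i hi) hA0) (mul_pos (ha i hi) hB0))
    rw [Real.log_div (mul_pos (hb i hi) hA0).ne' (mul_pos (ha i hi) hB0).ne',
      Real.log_mul (hb i hi).ne' hA0.ne', Real.log_mul (ha i hi).ne' hB0.ne'] at h1
    have h2 := mul_le_mul_of_nonneg_left h1 (ha i hi).le
    have h3 : a i * (b i * A / (a i * B) - 1) = b i * (A / B) - a i := by
      have := (ha i hi).ne'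
      field_simp
    rw [h3] at h2
    linarith
  have h := Finset.sum_le_sum key
  rw [Finset.sum_sub_distrib, Finset.sum_add_distrib, ← Finset.sum_mul, ← Finset.sum_mul,
    ← hA, ← hB, mul_div_cancel₀ _ hB0.ne'] at h
  linarith

/-- Joint convexity: `symKL` is the sum of the two relative entropy terms, and the log sum
inequality applies to each. -/
theorem symKL_avg_le {ι : Type*} {s : Finset ι} (hs : s.Nonempty) {a b : ι → ℝ}
    (ha : ∀ i ∈ s, 0 < a i) (hb : ∀ i ∈ s, 0 < b i) :
    symKL ((∑ i ∈ s, a i) / (s.card : ℝ)) ((∑ i ∈ s, b i) / (s.card : ℝ)) ≤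
      (∑ i ∈ s, symKL (a i) (b i)) / (s.card : ℝ) := by
  have hc : (0 : ℝ) < s.card := by exact_mod_cast Finset.card_pos.mpr hs
  have hA0 := Finset.sum_pos ha hs
  have hB0 := Finset.sum_pos hb hs
  have h1 := log_sum_inequality hs ha hb
  have h2 := log_sum_inequality hs hb ha
  have e : ∑ i ∈ s, symKL (a i) (b i) = ∑ i ∈ s, a i * (Real.log (a i) - Real.log (b i)) +
      ∑ i ∈ s, b i * (Real.log (b i) - Real.log (a i)) := by
    rw [← Finset.sum_add_distrib]
    exact Finset.sum_congr rfl fun i _ => by unfold symKL; ring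
  rw [e]
  unfold symKL
  rw [Real.log_div hA0.ne' hc.ne', Real.log_div hB0.ne' hc.ne', ← sub_div, sub_sub_sub_cancel_right,
    div_mul_eq_mul_div]
  refine div_le_div_of_nonneg_right ?_ hc.le
  linarith

theorem symKL_nonneg {a b : ℝ} (ha : 0 < a) (hb : 0 < b) : 0 ≤ symKL a b := by
  unfold symKL
  rcases le_total a b with h | h
  · exact mul_nonneg_of_nonpos_of_nonpos (sub_nonpos.mpr h)
      (sub_nonpos.mpr (Real.log_le_log ha h))
  · exact mul_nonneg (sub_nonneg.mpr h) (sub_nonneg.mpr (Real.log_le_log hb h))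

theorem eq_of_symKL_eq_zero {a b : ℝ} (ha : 0 < a) (hb : 0 < b) (h : symKL a b = 0) : a = b := by
  rcases mul_eq_zero.mp h with h | h
  · linarith
  · exact Real.log_injOn_pos ha hb (by linarith)

/-! ### Swap energy and the transposition walk. -/

theorem swap_mul_eq_mul_swap_inv (h : Perm α) (i j : α) :
    swap i j * h = h * swap (h⁻¹ i) (h⁻¹ j) := by
  rw [mul_swap_eq_swap_mul]
  simp

theorem sum_pairs_inv {S : Finset (α × α)} {h : Perm α}
    (hS : ∀ i j, (h i, h j) ∈ S ↔ (i, j) ∈ S) (F : α → α → ℝ) :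
    ∑ x ∈ S, F (h⁻¹ x.1) (h⁻¹ x.2) = ∑ x ∈ S, F x.1 x.2 := by
  refine Finset.sum_nbij' (fun x => (h⁻¹ x.1, h⁻¹ x.2)) (fun x => (h x.1, h x.2))
    ?_ ?_ ?_ ?_ ?_
  · rintro ⟨i, j⟩ hx
    rw [← hS]
    simpa using hx
  · rintro ⟨i, j⟩ hx
    exact (hS i j).mpr hx
  · simp
  · simp
  · simp

/-- Convexity moves the average outside `symKL`. Commuting a swap past `h` conjugates it, which only
permutes the pairs of `S` because `S` is stable under the stabiliser. -/
theorem swapEnergy_fixAvg_le {Q : Finset α} {S : Finset (α × α)}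
    (hS : ∀ h ∈ pointFixer Q, ∀ i j, (h i, h j) ∈ S ↔ (i, j) ∈ S)
    {f : Perm α → ℝ} (hf : ∀ σ, 0 < f σ) :
    swapEnergy S (fixAvg Q f) ≤ swapEnergy S f := by
  have step : ∀ x ∈ S, ∀ σ : Perm α,
      symKL (fixAvg Q f σ) (fixAvg Q f (σ * swap x.1 x.2)) ≤
      (∑ h ∈ pointFixer Q, symKL (f (σ * h)) (f (σ * h * swap (h⁻¹ x.1) (h⁻¹ x.2)))) /
        ((pointFixer Q).card : ℝ) := by
    intro x _ σ
    unfold fixAvg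
    refine (symKL_avg_le ⟨1, one_mem_pointFixer Q⟩ (fun _ _ => hf _) (fun _ _ => hf _)).trans
      (le_of_eq ?_)
    congr 1
    refine Finset.sum_congr rfl fun h _ => ?_
    rw [mul_assoc σ (swap _ _), swap_mul_eq_mul_swap_inv, mul_assoc σ h]
  have h1 : swapEnergy S (fixAvg Q f) ≤ ∑ x ∈ S, ∑ σ : Perm α,
      (∑ h ∈ pointFixer Q, symKL (f (σ * h)) (f (σ * h * swap (h⁻¹ x.1) (h⁻¹ x.2)))) /
        ((pointFixer Q).card : ℝ) :=
    Finset.sum_le_sum fun x hx => Finset.sum_le_sum fun σ _ => step x hx σ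
  refine h1.trans (le_of_eq ?_)
  have h2 : ∀ h ∈ pointFixer Q, ∑ x ∈ S, ∑ σ : Perm α,
      symKL (f (σ * h)) (f (σ * h * swap (h⁻¹ x.1) (h⁻¹ x.2))) = swapEnergy S f := by
    intro h hh
    rw [swapEnergy, ← sum_pairs_inv (hS h hh) fun i j => ∑ σ : Perm α,
      symKL (f σ) (f (σ * swap i j))]
    exact Finset.sum_congr rfl fun x _ => sum_mul_right_perm
      (fun σ => symKL (f σ) (f (σ * swap (h⁻¹ x.1) (h⁻¹ x.2)))) h
  simp only [← Finset.sum_div]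
  rw [Finset.sum_congr rfl fun x _ => Finset.sum_comm, Finset.sum_comm, Finset.sum_congr rfl h2,
    Finset.sum_const, nsmul_eq_mul]
  exact mul_div_cancel_left₀ _ (card_pointFixer_pos Q).ne'

/-- A swap of two points outside `Q` lies in the stabiliser and leaves the average unchanged, so
only pairs that meet `Q` carry energy. This is where the factor `c` of the entropy inequality
originates. -/
theorem swapEnergy_fixAvg_le_filter {I Q : Finset α} (hIQ : I ⊆ Q)
    {f : Perm α → ℝ} (hf : ∀ σ, 0 < f σ) :
    swapEnergy (Iᶜ ×ˢ Iᶜ) (fixAvg Q f) ≤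
      swapEnergy ((Iᶜ ×ˢ Iᶜ).filter fun x => x.1 ∈ Q ∨ x.2 ∈ Q) f := by
  refine le_trans (le_of_eq ?_) (swapEnergy_fixAvg_le (Q := Q) ?_ hf)
  · unfold swapEnergy
    symm
    refine Finset.sum_subset (Finset.filter_subset _ _) fun x hx hx' => ?_
    have hxQ : x.1 ∉ Q ∧ x.2 ∉ Q := by
      simp only [Finset.mem_filter, hx, true_and, not_or] at hx'
      exact hx'
    refine Finset.sum_eq_zero fun σ _ => ?_
    rw [fixAvg_mul_right]
    · simp [symKL]
    · rw [mem_pointFixer]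
      intro q hq
      exact swap_apply_of_ne_of_ne (fun e => hxQ.1 (e ▸ hq)) (fun e => hxQ.2 (e ▸ hq))
  · intro h hh i j
    simp only [Finset.mem_filter, Finset.mem_product, Finset.mem_compl,
      apply_mem_iff_of_mem_pointFixer hh, apply_mem_iff_of_mem_pointFixer (pointFixer_anti hIQ hh)]

/-- Conjugation by the stabiliser permutes the swaps outside `I`. Hence a step of the walk from `f`
induces a step of the same walk from each of its averages. -/
theorem fixAvg_swapGen {I Q : Finset α} (hIQ : I ⊆ Q) (f : Perm α → ℝ) :
    fixAvg Q (swapGen (Iᶜ ×ˢ Iᶜ) f) = swapGen (Iᶜ ×ˢ Iᶜ) (fixAvg Q f) := by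
  funext σ
  unfold swapGen
  have hS : ∀ h ∈ pointFixer Q, ∀ i j, (h i, h j) ∈ Iᶜ ×ˢ Iᶜ ↔ (i, j) ∈ Iᶜ ×ˢ Iᶜ := by
    intro h hh i j
    simp only [Finset.mem_product, Finset.mem_compl,
      apply_mem_iff_of_mem_pointFixer (pointFixer_anti hIQ hh)]
  unfold fixAvg
  have e : ∀ h ∈ pointFixer Q,
      ∑ x ∈ Iᶜ ×ˢ Iᶜ, (f (σ * h * swap x.1 x.2) - f (σ * h)) =
      ∑ x ∈ Iᶜ ×ˢ Iᶜ, (f (σ * swap x.1 x.2 * h) - f (σ * h)) := by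
    intro h hh
    rw [← sum_pairs_inv (hS h hh) fun i j => f (σ * h * swap i j) - f (σ * h)]
    refine Finset.sum_congr rfl fun x _ => ?_
    rw [mul_assoc σ (swap _ _), swap_mul_eq_mul_swap_inv, mul_assoc σ h]
  rw [Finset.sum_congr rfl e, Finset.sum_comm, Finset.sum_div]
  refine Finset.sum_congr rfl fun x _ => ?_
  rw [Finset.sum_sub_distrib, sub_div]

/-- Summation by parts: each swap is an involution, so the walk is reversible for the uniform
distribution. -/
theorem sum_swapGen_mul (S : Finset (α × α)) (f φ : Perm α → ℝ) :
    ∑ σ, swapGen S f σ * φ σ =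
      -(1 / 2) * ∑ x ∈ S, ∑ σ, (f σ - f (σ * swap x.1 x.2)) * (φ σ - φ (σ * swap x.1 x.2)) := by
  simp only [swapGen, Finset.sum_mul]
  rw [Finset.sum_comm, Finset.mul_sum]
  refine Finset.sum_congr rfl fun x _ => ?_
  have h1 := sum_mul_right_perm (fun σ => (f σ - f (σ * swap x.1 x.2)) * φ (σ * swap x.1 x.2))
    (swap x.1 x.2)
  simp only [mul_assoc, swap_mul_self, mul_one] at h1
  have h2 : ∑ σ, (f σ - f (σ * swap x.1 x.2)) * (φ σ - φ (σ * swap x.1 x.2)) =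
      -∑ σ, (f (σ * swap x.1 x.2) - f σ) * φ σ -
        ∑ σ, (f σ - f (σ * swap x.1 x.2)) * φ (σ * swap x.1 x.2) := by
    rw [← Finset.sum_neg_distrib, ← Finset.sum_sub_distrib]
    exact Finset.sum_congr rfl fun σ _ => by ring
  rw [h2, ← h1]
  ring

theorem hasDerivAt_negEnt {f : Perm α → ℝ} (hf : ∀ σ, 0 < f σ) (g : Perm α → ℝ) :
    HasDerivAt (fun ε : ℝ => negEnt fun σ => f σ + ε * g σ)
      (∑ σ, g σ * (Real.log (f σ) + 1)) 0 := by
  unfold negEnt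
  refine HasDerivAt.fun_sum fun σ _ => ?_
  have h1 : HasDerivAt (fun ε : ℝ => f σ + ε * g σ) (g σ) 0 := by
    simpa using ((hasDerivAt_id (0 : ℝ)).mul_const (g σ)).const_add (f σ)
  have h2 := Real.hasDerivAt_mul_log (x := f σ + 0 * g σ) (by simpa using (hf σ).ne')
  have h3 := h2.comp (0 : ℝ) h1
  exact HasDerivAt.congr_deriv h3 (by simp [mul_comm])

theorem hasDerivAt_negEnt_swapGen (S : Finset (α × α)) {f : Perm α → ℝ} (hf : ∀ σ, 0 < f σ) :
    HasDerivAt (fun ε : ℝ => negEnt fun σ => f σ + ε * swapGen S f σ)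
      (-(1 / 2) * swapEnergy S f) 0 := by
  convert hasDerivAt_negEnt hf (swapGen S f) using 1
  rw [sum_swapGen_mul, swapEnergy]
  -- The constant `+ 1` in the derivative of `x * log x` cancels in the differences along swaps.
  simp [symKL]

/-- The stabiliser of `I` is generated by transpositions of points outside `I`: composing with the
swap of `x` and `h x` shrinks the support. -/
theorem invariant_of_swap_invariant {I : Finset α} {f : Perm α → ℝ}
    (hf : ∀ i ∉ I, ∀ j ∉ I, ∀ σ, f (σ * swap i j) = f σ) :
    ∀ h ∈ pointFixer I, ∀ σ, f (σ * h) = f σ := by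
  suffices H : ∀ n : ℕ, ∀ h ∈ pointFixer I, h.support.card = n → ∀ σ, f (σ * h) = f σ from
    fun h hh => H _ h hh rfl
  intro n
  induction n using Nat.strong_induction_on with
  | _ n ih =>
    intro h hh hn σ
    by_cases h1 : h = 1
    · simp [h1]
    obtain ⟨x, hx⟩ : ∃ x, h x ≠ x := by
      by_contra hcon
      push Not at hcon
      exact h1 (Equiv.ext hcon)
    have hxI : x ∉ I := fun hxI => hx (mem_pointFixer.mp hh x hxI)
    have hhxI : h x ∉ I := by rwa [apply_mem_iff_of_mem_pointFixer hh]
    have hs : swap x (h x) ∈ pointFixer I := by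
      rw [mem_pointFixer]
      intro q hq
      exact swap_apply_of_ne_of_ne (fun e => hxI (e ▸ hq)) (fun e => hhxI (e ▸ hq))
    have hdec := Perm.card_support_swap_mul hx
    have := ih _ (hn ▸ hdec) (swap x (h x) * h) (mul_mem_pointFixer hs hh) rfl
      (σ * swap x (h x))
    rw [mul_assoc, swap_mul_self_mul] at this
    rw [this, hf x hxI (h x) hhxI]

theorem deriv_nonpos_of_right_max {φ : ℝ → ℝ} {m δ : ℝ} (hδ : 0 < δ) (h : HasDerivAt φ m 0)
    (hmax : ∀ ε, 0 ≤ ε → ε ≤ δ → φ ε ≤ φ 0) : m ≤ 0 := by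
  have ht := h.tendsto_slope_zero_right
  refine le_of_tendsto ht ?_
  have : Set.Ioc (0 : ℝ) δ ∈ nhdsWithin (0 : ℝ) (Set.Ioi 0) := Ioc_mem_nhdsGT hδ
  filter_upwards [this] with t ht
  simp only [zero_add, smul_eq_mul]
  exact mul_nonpos_of_nonneg_of_nonpos (inv_nonneg.mpr ht.1.le)
    (sub_nonpos.mpr (hmax t ht.1.le ht.2))

/-- Exchange the sums: each pair of points is counted with the total weight of the sets that it
meets. -/
theorem sum_swapEnergy_filter_le {ι : Type*} [Fintype ι] {w : ι → ℝ}
    {Q : ι → Finset α} {I : Finset α} {c : ℝ}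
    (hc : ∀ i ∉ I, ∀ j ∉ I, (∑ d, if i ∈ Q d ∨ j ∈ Q d then w d else 0) ≤ c)
    {f : Perm α → ℝ} (hf : ∀ σ, 0 < f σ) :
    ∑ d, w d * swapEnergy ((Iᶜ ×ˢ Iᶜ).filter fun x => x.1 ∈ Q d ∨ x.2 ∈ Q d) f ≤
      c * swapEnergy (Iᶜ ×ˢ Iᶜ) f := by
  have e : ∑ d, w d * swapEnergy ((Iᶜ ×ˢ Iᶜ).filter fun x => x.1 ∈ Q d ∨ x.2 ∈ Q d) f =
      ∑ x ∈ Iᶜ ×ˢ Iᶜ, (∑ d, if x.1 ∈ Q d ∨ x.2 ∈ Q d then w d else 0) *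
        ∑ σ : Perm α, symKL (f σ) (f (σ * swap x.1 x.2)) := by
    simp only [swapEnergy, Finset.sum_filter, Finset.mul_sum (s := Iᶜ ×ˢ Iᶜ)]
    rw [Finset.sum_comm]
    refine Finset.sum_congr rfl fun x _ => ?_
    rw [Finset.sum_mul]
    refine Finset.sum_congr rfl fun d _ => ?_
    split_ifs <;> simp
  rw [e, swapEnergy, Finset.mul_sum]
  refine Finset.sum_le_sum fun x hx => mul_le_mul_of_nonneg_right ?_
    (Finset.sum_nonneg fun σ _ => symKL_nonneg (hf _) (hf _))
  simp only [Finset.mem_product, Finset.mem_compl] at hx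
  exact hc _ hx.1 _ hx.2

/-- For `ε * S.card ≤ 1` the new value is a convex combination of values of `f`. -/
theorem le_add_mul_swapGen {S : Finset (α × α)} {f : Perm α → ℝ} {η : ℝ} (hf : ∀ σ, η ≤ f σ)
    {ε : ℝ} (h0 : 0 ≤ ε) (h1 : ε ≤ 1 / ((S.card : ℝ) + 1)) (σ : Perm α) :
    η ≤ f σ + ε * swapGen S f σ := by
  have hc : (0 : ℝ) ≤ S.card := Nat.cast_nonneg _
  have hε : ε * S.card ≤ 1 := by
    rw [le_div_iff₀ (by positivity)] at h1
    linarith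
  have h2 : (S.card : ℝ) * (η - f σ) ≤ swapGen S f σ := by
    unfold swapGen
    rw [← nsmul_eq_mul]
    exact Finset.card_nsmul_le_sum _ _ _ fun x _ => sub_le_sub_right (hf _) _
  have h3 := mul_le_mul_of_nonneg_left h2 h0
  nlinarith [hf σ]

/-- The strict inequality `c < c'` forces the energy of a maximiser to be exactly zero; the case `c'
= c` is then a limit. -/
theorem sum_negEnt_fixAvg_sub_le_of_lt {ι : Type*} [Fintype ι] {w : ι → ℝ} (hw : ∀ d, 0 ≤ w d)
    {Q : ι → Finset α} {I : Finset α} (hI : ∀ d, I ⊆ Q d) {c c' : ℝ} (hcc : c < c')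
    (hc : ∀ i ∉ I, ∀ j ∉ I, (∑ d, if i ∈ Q d ∨ j ∈ Q d then w d else 0) ≤ c)
    {f : Perm α → ℝ} (hf : ∀ σ, 0 < f σ) :
    ∑ d, w d * negEnt (fixAvg (Q d) f) - c' * negEnt f ≤
      ∑ d, w d * negEnt (fixAvg I f) - c' * negEnt (fixAvg I f) := by
  obtain ⟨σm, hσm⟩ := Finite.exists_min f
  set η := f σm with hη
  have hη0 : 0 < η := hf σm
  set g := fixAvg I f with hg
  set s := ∑ σ, f σ with hs
  -- The lower bound `η > 0` keeps the logarithms differentiable, and the walk preserves it. Fixing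
  -- the average over `I` fixes the total mass, which makes `K` bounded.
  let K : Set (Perm α → ℝ) := {u | (∀ σ, η ≤ u σ) ∧ ∀ σ, fixAvg I u σ = g σ}
  let G : (Perm α → ℝ) → ℝ := fun u => ∑ d, w d * negEnt (fixAvg (Q d) u) - c' * negEnt u
  have hKc : IsCompact K := by
    have hcl : IsClosed K := by
      have e : K = (⋂ σ, {u | η ≤ u σ}) ∩ ⋂ σ, {u | fixAvg I u σ = g σ} := by
        ext u; simp [K]
      rw [e]
      exact (isClosed_iInter fun σ => isClosed_le continuous_const (continuous_apply σ)).inter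
        (isClosed_iInter fun σ => isClosed_eq (continuous_fixAvg I σ) continuous_const)
    refine IsCompact.of_isClosed_subset
      (isCompact_univ_pi fun _ : Perm α => isCompact_Icc (a := η) (b := s)) hcl ?_
    rintro u ⟨hu1, hu2⟩ σ -
    refine ⟨hu1 σ, ?_⟩
    have : ∑ τ, u τ = s := by
      rw [← sum_fixAvg I u, hs, ← sum_fixAvg I f]
      exact Finset.sum_congr rfl fun τ _ => hu2 τ
    rw [← this]
    exact Finset.single_le_sum (f := u) (fun τ _ => hη0.le.trans (hu1 τ)) (Finset.mem_univ σ)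
  have hGc : Continuous G := by
    refine Continuous.sub (continuous_finsetSum _ fun d _ => ?_)
      (continuous_const.mul continuous_negEnt)
    exact continuous_const.mul (continuous_negEnt.comp
      (continuous_pi fun σ => continuous_fixAvg (Q d) σ))
  have hfK : f ∈ K := ⟨hσm, fun _ => rfl⟩
  obtain ⟨u, ⟨hu1, hu2⟩, humax⟩ := hKc.exists_isMaxOn ⟨f, hfK⟩ hGc.continuousOn
  have hu0 : ∀ σ, 0 < u σ := fun σ => hη0.trans_le (hu1 σ)
  set S : Finset (α × α) := Iᶜ ×ˢ Iᶜ with hS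
  have hswap : ∀ x ∈ S, swap x.1 x.2 ∈ pointFixer I := by
    intro x hx
    simp only [hS, Finset.mem_product, Finset.mem_compl] at hx
    rw [mem_pointFixer]
    exact fun q hq => swap_apply_of_ne_of_ne (fun e => hx.1 (e ▸ hq)) (fun e => hx.2 (e ▸ hq))
  have hpath : ∀ ε, 0 ≤ ε → ε ≤ 1 / ((S.card : ℝ) + 1) →
      (fun σ => u σ + ε * swapGen S u σ) ∈ K := by
    intro ε h0 h1
    refine ⟨fun σ => le_add_mul_swapGen hu1 h0 h1 σ, fun σ => ?_⟩
    rw [fixAvg_add_mul, fixAvg_swapGen (le_refl I), hu2 σ, swapGen]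
    have : ∀ x ∈ S, fixAvg I u (σ * swap x.1 x.2) - fixAvg I u σ = 0 := fun x hx => by
      rw [fixAvg_mul_right (hswap x hx), sub_self]
    rw [Finset.sum_eq_zero this]
    ring
  have hderiv : HasDerivAt (fun ε : ℝ => G fun σ => u σ + ε * swapGen S u σ)
      (∑ d, w d * (-(1 / 2) * swapEnergy S (fixAvg (Q d) u)) -
        c' * (-(1 / 2) * swapEnergy S u)) 0 := by
    refine HasDerivAt.sub (HasDerivAt.fun_sum fun d _ => ?_)
      ((hasDerivAt_negEnt_swapGen S hu0).const_mul c')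
    refine HasDerivAt.const_mul (w d) ?_
    have := hasDerivAt_negEnt_swapGen S (fun σ => fixAvg_pos (Q := Q d) hu0 σ)
    rw [hS, ← fixAvg_swapGen (hI d)] at this
    simpa only [← fixAvg_add_mul] using this
  have hle := deriv_nonpos_of_right_max (δ := 1 / ((S.card : ℝ) + 1)) (by positivity) hderiv (by
    intro ε h0 h1
    have := isMaxOn_iff.mp humax _ (hpath ε h0 h1)
    simpa using this)
  have hE1 : ∑ d, w d * swapEnergy S (fixAvg (Q d) u) ≤ c * swapEnergy S u :=
    (Finset.sum_le_sum fun d _ => mul_le_mul_of_nonneg_left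
      (swapEnergy_fixAvg_le_filter (hI d) hu0) (hw d)).trans (sum_swapEnergy_filter_le hc hu0)
  have hE0 : 0 ≤ swapEnergy S u := Finset.sum_nonneg fun x _ => Finset.sum_nonneg fun σ _ =>
    symKL_nonneg (hu0 _) (hu0 _)
  -- First-order optimality gives `c' * E ≤ ∑ d, w d * E d`, while `hE1` bounds the right side by `c
  -- * E`.
  have hEz : swapEnergy S u = 0 := by
    have e : ∑ d, w d * (-(1 / 2) * swapEnergy S (fixAvg (Q d) u)) =
        -(1 / 2) * ∑ d, w d * swapEnergy S (fixAvg (Q d) u) := by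
      rw [Finset.mul_sum]
      exact Finset.sum_congr rfl fun d _ => by ring
    rw [e] at hle
    nlinarith
  have hinv : ∀ h ∈ pointFixer I, ∀ σ, u (σ * h) = u σ := by
    apply invariant_of_swap_invariant
    intro i hi j hj σ
    have h1 := (Finset.sum_eq_zero_iff_of_nonneg fun x _ => Finset.sum_nonneg fun σ _ =>
      symKL_nonneg (hu0 σ) (hu0 (σ * swap x.1 x.2))).mp hEz (i, j) (by simp [hS, hi, hj])
    have h2 := (Finset.sum_eq_zero_iff_of_nonneg fun σ _ =>
      symKL_nonneg (hu0 σ) (hu0 (σ * swap i j))).mp h1 σ (Finset.mem_univ σ)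
    exact (eq_of_symKL_eq_zero (hu0 _) (hu0 _) h2).symm
  have hug : u = g := by
    rw [← fixAvg_of_invariant hinv]
    exact funext hu2
  have hQg : ∀ d, fixAvg (Q d) u = g := fun d => by
    rw [fixAvg_of_invariant fun h hh => hinv h (pointFixer_anti (hI d) hh), hug]
  -- At the maximiser all averages equal `g`, so comparing `f` with it is the claim.
  have hfin := isMaxOn_iff.mp humax f hfK
  simp only [G, hQg] at hfin
  rwa [hug] at hfin

/-- Subadditivity of entropy on the symmetric group, relative to the values on `I`: if every pair
of points outside `I` meets the sets `Q d` with total weight at most `c`, then the weighted sum of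
the entropies of the restrictions to the `Q d` is at most `c` times the entropy. -/
theorem sum_negEnt_fixAvg_le {ι : Type*} [Fintype ι] {w : ι → ℝ} (hw : ∀ d, 0 ≤ w d)
    {Q : ι → Finset α} {I : Finset α} (hI : ∀ d, I ⊆ Q d) {c : ℝ}
    (hc : ∀ i ∉ I, ∀ j ∉ I, (∑ d, if i ∈ Q d ∨ j ∈ Q d then w d else 0) ≤ c)
    {f : Perm α → ℝ} (hf : ∀ σ, 0 < f σ) :
    ∑ d, w d * (negEnt (fixAvg (Q d) f) - negEnt (fixAvg I f)) ≤
      c * (negEnt f - negEnt (fixAvg I f)) := by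
  have key : ∀ c' ∈ Set.Ioi c, ∑ d, w d * (negEnt (fixAvg (Q d) f) - negEnt (fixAvg I f)) ≤
      c' * (negEnt f - negEnt (fixAvg I f)) := by
    intro c' hc'
    have := sum_negEnt_fixAvg_sub_le_of_lt hw hI hc' hc hf
    simp only [mul_sub, Finset.sum_sub_distrib]
    linarith
  have ht : Filter.Tendsto (fun c' : ℝ => c' * (negEnt f - negEnt (fixAvg I f)))
      (nhdsWithin c (Set.Ioi c)) (nhds (c * (negEnt f - negEnt (fixAvg I f)))) :=
    ((continuous_id.mul continuous_const).tendsto c).mono_left nhdsWithin_le_nhds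
  exact ge_of_tendsto ht (Filter.eventually_of_mem self_mem_nhdsWithin key)

end PermEntropy

/-! ### Exponential moments and maxima over advice strings. -/

section ExponentialMoment

open Equiv Finset

/-- Hoeffding's lemma for a finitely supported distribution. -/
theorem sum_mul_exp_le_of_mem_Icc {Ω : Type*} [Fintype Ω] {g φ : Ω → ℝ} (hg : ∀ x, 0 ≤ g x)
    (hg1 : ∑ x, g x = 1) (hφ0 : ∀ x, 0 ≤ φ x) (hφ1 : ∀ x, φ x ≤ 1) (μ : ℝ) :
    ∑ x, g x * Real.exp (μ * φ x) ≤ Real.exp (μ * ∑ x, g x * φ x + μ ^ 2 / 8) := by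
  classical
  let _ : MeasurableSpace Ω := ⊤
  have : MeasurableSingletonClass Ω := ⟨fun _ => trivial⟩
  have h1 : ∑ x, ENNReal.ofReal (g x) = 1 := by
    rw [← ENNReal.ofReal_sum_of_nonneg fun x _ => hg x, hg1, ENNReal.ofReal_one]
  set p : PMF Ω := PMF.ofFintype (fun x => ENNReal.ofReal (g x)) h1 with hp
  have hint : ∀ F : Ω → ℝ, ∫ x, F x ∂p.toMeasure = ∑ x, g x * F x := by
    intro F
    rw [PMF.integral_eq_sum]
    refine Finset.sum_congr rfl fun x _ => ?_
    simp [hp, ENNReal.toReal_ofReal (hg x)]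
  have hH := ProbabilityTheory.hasSubgaussianMGF_of_mem_Icc (X := φ) (μ := p.toMeasure)
    (a := 0) (b := 1) (measurable_from_top.aemeasurable)
    (Filter.Eventually.of_forall fun x => ⟨hφ0 x, hφ1 x⟩)
  have h2 := hH.mgf_le μ
  rw [ProbabilityTheory.mgf, hint, hint] at h2
  set m := ∑ x, g x * φ x with hm
  have h3 : ∑ x, g x * Real.exp (μ * (φ x - m)) =
      (∑ x, g x * Real.exp (μ * φ x)) * Real.exp (-(μ * m)) := by
    rw [Finset.sum_mul]
    refine Finset.sum_congr rfl fun x _ => ?_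
    rw [mul_assoc, ← Real.exp_add]
    ring_nf
  rw [h3] at h2
  have h4 := mul_le_mul_of_nonneg_right h2 (Real.exp_pos (μ * m)).le
  rw [mul_assoc, ← Real.exp_add, ← Real.exp_add] at h4
  simp only [neg_add_cancel, Real.exp_zero, mul_one] at h4
  refine h4.trans (le_of_eq ?_)
  congr 1
  simp
  ring

/-- Change of measure for a function with values in the unit interval. -/
theorem mul_sum_le_relEntropy_add {Ω : Type*} [Fintype Ω] [Nonempty Ω] {f g φ : Ω → ℝ}
    (hf : ∀ x, 0 < f x) (hf1 : ∑ x, f x = 1) (hg : ∀ x, 0 < g x) (hg1 : ∑ x, g x = 1)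
    (hφ0 : ∀ x, 0 ≤ φ x) (hφ1 : ∀ x, φ x ≤ 1) (μ : ℝ) :
    μ * ∑ x, f x * φ x ≤
      ∑ x, f x * (Real.log (f x) - Real.log (g x)) + μ * ∑ x, g x * φ x + μ ^ 2 / 8 := by
  have h1 := log_sum_inequality (s := Finset.univ) Finset.univ_nonempty (a := f)
    (b := fun x => g x * Real.exp (μ * φ x)) (fun x _ => hf x)
    (fun x _ => mul_pos (hg x) (Real.exp_pos _))
  have hpos : 0 < ∑ x, g x * Real.exp (μ * φ x) :=
    Finset.sum_pos (fun x _ => mul_pos (hg x) (Real.exp_pos _)) Finset.univ_nonempty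
  have h2 := Real.log_le_log hpos
    (sum_mul_exp_le_of_mem_Icc (fun x => (hg x).le) hg1 hφ0 hφ1 μ)
  rw [Real.log_exp] at h2
  have h3 : ∑ x, f x * (Real.log (f x) - Real.log (g x * Real.exp (μ * φ x))) =
      ∑ x, f x * (Real.log (f x) - Real.log (g x)) - μ * ∑ x, f x * φ x := by
    rw [Finset.mul_sum, ← Finset.sum_sub_distrib]
    refine Finset.sum_congr rfl fun x _ => ?_
    rw [Real.log_mul (hg x).ne' (Real.exp_pos _).ne', Real.log_exp]
    ring
  rw [h3, hf1, Real.log_one] at h1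
  linarith

variable {α : Type*} [Fintype α] [DecidableEq α]

/-- Exponential moment of an average of functions of few values of a uniform permutation. -/
theorem sum_exp_avg_le {ι : Type*} [Fintype ι] [Nonempty ι] {φ : ι → Perm α → ℝ}
    (hφ0 : ∀ d σ, 0 ≤ φ d σ) (hφ1 : ∀ d σ, φ d σ ≤ 1)
    {Q : ι → Finset α} {I : Finset α} (hI : ∀ d, I ⊆ Q d)
    (hφQ : ∀ d, ∀ h ∈ pointFixer (Q d), ∀ σ, φ d (σ * h) = φ d σ) {M c l : ℝ}
    (hM : ∀ g : Perm α → ℝ, (∀ σ, 0 ≤ g σ) → (∀ h ∈ pointFixer I, ∀ σ, g (σ * h) = g σ) →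
      ∑ σ, g σ * ((∑ d, φ d σ) / (Fintype.card ι : ℝ)) ≤ M * ∑ σ, g σ)
    (hl : 0 ≤ l) (hc0 : 0 < c)
    (hc : ∀ i ∉ I, ∀ j ∉ I, ((Finset.univ.filter fun d => i ∈ Q d ∨ j ∈ Q d).card : ℝ) ≤
      c * (Fintype.card ι : ℝ)) :
    ∑ σ, Real.exp (l * ((∑ d, φ d σ) / (Fintype.card ι : ℝ))) ≤
      (Fintype.card (Perm α) : ℝ) * Real.exp (l * M + l ^ 2 * c / 8) := by
  set k : ℝ := (Fintype.card ι : ℝ) with hk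
  have hk0 : 0 < k := by rw [hk]; exact_mod_cast Fintype.card_pos
  set n : ℝ := (Fintype.card (Perm α) : ℝ) with hn
  have hn0 : 0 < n := by rw [hn]; exact_mod_cast Fintype.card_pos
  set F : Perm α → ℝ := fun σ => (∑ d, φ d σ) / k with hF
  set Z := ∑ σ, Real.exp (l * F σ) with hZ
  have hZ0 : 0 < Z := Finset.sum_pos (fun _ _ => Real.exp_pos _) Finset.univ_nonempty
  -- The Gibbs density, for which the variational bound on `log Z` is an equality (`hEnt`).
  set f : Perm α → ℝ := fun σ => Real.exp (l * F σ) / Z with hf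
  have hf0 : ∀ σ, 0 < f σ := fun σ => div_pos (Real.exp_pos _) hZ0
  have hf1 : ∑ σ, f σ = 1 := by
    rw [hf, ← Finset.sum_div, ← hZ, div_self hZ0.ne']
  have hEnt : negEnt f = l * ∑ σ, f σ * F σ - Real.log Z := by
    have : ∀ σ, f σ * Real.log (f σ) = l * (f σ * F σ) - f σ * Real.log Z := by
      intro σ
      have : Real.log (f σ) = l * F σ - Real.log Z := by
        rw [hf, Real.log_div (Real.exp_pos _).ne' hZ0.ne', Real.log_exp]
      rw [this]
      ring
    rw [negEnt, Finset.sum_congr rfl fun σ _ => this σ, Finset.sum_sub_distrib, ← Finset.mul_sum,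
      ← Finset.sum_mul, hf1, one_mul]
  have hI0 : ∀ σ, 0 < fixAvg I f σ := fixAvg_pos hf0
  have hI1 : ∑ σ, fixAvg I f σ = 1 := by rw [sum_fixAvg, hf1]
  have hEntI : -Real.log n ≤ negEnt (fixAvg I f) := by
    have := log_sum_inequality (s := Finset.univ) Finset.univ_nonempty (a := fixAvg I f)
      (b := fun _ => 1) (fun x _ => hI0 x) (fun x _ => one_pos)
    rw [hI1] at this
    simpa [negEnt, hn] using this
  -- The exponent is `c * l` rather than `l`: subadditivity returns a factor `c` on the entropy,
  -- which can then be divided out, leaving `l ^ 2 * c / 8` as the variance term.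
  have hd : ∀ d, c * l * ∑ σ, f σ * φ d σ ≤ (negEnt (fixAvg (Q d) f) - negEnt (fixAvg I f)) +
      c * l * ∑ σ, fixAvg I f σ * φ d σ + (c * l) ^ 2 / 8 := by
    intro d
    rw [← sum_fixAvg_mul f (hφQ d), negEnt_sub_negEnt_fixAvg (hI d)]
    exact mul_sum_le_relEntropy_add (fixAvg_pos hf0) (by rw [sum_fixAvg, hf1]) hI0 hI1
      (hφ0 d) (hφ1 d) (c * l)
  have havg : ∀ g : Perm α → ℝ, ∑ d, k⁻¹ * ∑ σ, g σ * φ d σ = ∑ σ, g σ * F σ := by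
    intro g
    simp only [hF, Finset.mul_sum]
    rw [Finset.sum_comm]
    refine Finset.sum_congr rfl fun σ _ => ?_
    rw [div_eq_inv_mul, Finset.mul_sum, Finset.mul_sum]
    exact Finset.sum_congr rfl fun d _ => by ring
  have hw : ∑ _d : ι, k⁻¹ = 1 := by
    rw [Finset.sum_const, nsmul_eq_mul, Finset.card_univ, ← hk, mul_inv_cancel₀ hk0.ne']
  have hsum := Finset.sum_le_sum fun d (_ : d ∈ Finset.univ) =>
    mul_le_mul_of_nonneg_left (hd d) (inv_pos.mpr hk0).le
  have e1 : ∑ d, k⁻¹ * (c * l * ∑ σ, f σ * φ d σ) = c * l * ∑ σ, f σ * F σ := by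
    rw [← havg, Finset.mul_sum]
    exact Finset.sum_congr rfl fun d _ => by ring
  have e2 : ∑ d, k⁻¹ * ((negEnt (fixAvg (Q d) f) - negEnt (fixAvg I f)) +
      c * l * ∑ σ, fixAvg I f σ * φ d σ + (c * l) ^ 2 / 8) =
      ∑ d, k⁻¹ * (negEnt (fixAvg (Q d) f) - negEnt (fixAvg I f)) +
        c * l * ∑ σ, fixAvg I f σ * F σ + (c * l) ^ 2 / 8 := by
    have : (c * l) ^ 2 / 8 = ∑ _d : ι, k⁻¹ * ((c * l) ^ 2 / 8) := by
      rw [← Finset.sum_mul, hw, one_mul]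
    rw [← havg]
    conv_rhs => rw [this]
    rw [Finset.mul_sum, ← Finset.sum_add_distrib, ← Finset.sum_add_distrib]
    exact Finset.sum_congr rfl fun d _ => by ring
  rw [e1, e2] at hsum
  have hsub := sum_negEnt_fixAvg_le (w := fun _ : ι => k⁻¹) (fun _ => (inv_pos.mpr hk0).le) hI
    (c := c) (by
      intro i hi j hj
      rw [← Finset.sum_filter, Finset.sum_const, nsmul_eq_mul, ← div_eq_mul_inv,
        div_le_iff₀ hk0]
      exact hc i hi j hj) hf0
  have hMI : ∑ σ, fixAvg I f σ * F σ ≤ M := by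
    have := hM (fixAvg I f) (fun σ => (hI0 σ).le) fun h hh σ => fixAvg_mul_right hh f σ
    rwa [hI1, mul_one] at this
  have h5 : c * l * ∑ σ, fixAvg I f σ * F σ ≤ c * l * M :=
    mul_le_mul_of_nonneg_left hMI (mul_nonneg hc0.le hl)
  have h6 : c * (l * ∑ σ, f σ * F σ) ≤
      c * (negEnt f - negEnt (fixAvg I f) + l * M + l ^ 2 * c / 8) := by
    nlinarith
  -- After division by `c`, the mean of `F` under `f` cancels against `hEnt`, and `hEntI` removes
  -- the entropy on `I`.
  have h7 := le_of_mul_le_mul_left h6 hc0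
  have h8 : Real.log Z ≤ Real.log n + (l * M + l ^ 2 * c / 8) := by linarith
  calc Z = Real.exp (Real.log Z) := (Real.exp_log hZ0).symm
    _ ≤ Real.exp (Real.log n + (l * M + l ^ 2 * c / 8)) := Real.exp_le_exp.mpr h8
    _ = n * Real.exp (l * M + l ^ 2 * c / 8) := by rw [Real.exp_add, Real.exp_log hn0]

/-- Expected value of a maximum through exponential moments. -/
theorem sum_select_le {Ω Z : Type*} [Fintype Ω] [Nonempty Ω] [Fintype Z] (F : Z → Ω → ℝ)
    (a : Ω → Z) {l B : ℝ}
    (hF : ∀ z, ∑ x, Real.exp (l * F z x) ≤ (Fintype.card Ω : ℝ) * Real.exp B) :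
    l * ((∑ x, F (a x) x) / (Fintype.card Ω : ℝ)) ≤ Real.log (Fintype.card Z) + B := by
  set n : ℝ := (Fintype.card Ω : ℝ) with hn
  have hn0 : 0 < n := by rw [hn]; exact_mod_cast Fintype.card_pos
  have : Nonempty Z := ⟨a (Classical.arbitrary Ω)⟩
  have hz0 : (0 : ℝ) < Fintype.card Z := by exact_mod_cast Fintype.card_pos
  set m := (∑ x, F (a x) x) / n with hm
  -- Jensen's inequality by hand: the tangent of `exp` at `l * m`, where the deviations from the
  -- mean `m` cancel in the sum. The selected term is bounded by the sum over all advice strings.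
  have h1 : ∀ x, Real.exp (l * m) * (l * F (a x) x - l * m + 1) ≤
      ∑ z, Real.exp (l * F z x) := by
    intro x
    refine le_trans ?_ (Finset.single_le_sum (f := fun z => Real.exp (l * F z x))
      (fun z _ => (Real.exp_pos _).le) (Finset.mem_univ (a x)))
    have h := mul_le_mul_of_nonneg_left (Real.add_one_le_exp (l * F (a x) x - l * m))
      (Real.exp_pos (l * m)).le
    rwa [← Real.exp_add, add_sub_cancel] at h
  have h2 := Finset.sum_le_sum fun x (_ : x ∈ Finset.univ) => h1 x
  rw [Finset.sum_comm] at h2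
  have h3 := h2.trans (Finset.sum_le_sum fun z _ => hF z)
  have h4 : ∑ x, (l * F (a x) x - l * m + 1) = n := by
    rw [Finset.sum_add_distrib, Finset.sum_sub_distrib, ← Finset.mul_sum]
    simp only [Finset.sum_const, Finset.card_univ, nsmul_eq_mul, ← hn]
    rw [hm]
    field_simp
    ring
  rw [← Finset.mul_sum, h4, Finset.sum_const, Finset.card_univ, nsmul_eq_mul] at h3
  have h5 : Real.exp (l * m) ≤ Fintype.card Z * Real.exp B := by
    refine le_of_mul_le_mul_right ?_ hn0
    linarith
  have h6 := Real.log_le_log (Real.exp_pos _) h5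
  rwa [Real.log_exp, Real.log_mul hz0.ne' (Real.exp_pos _).ne', Real.log_exp] at h6

/-- Optimisation of the exponent in an exponential moment bound. -/
theorem le_add_sqrt_of_forall_exponent {x M a c₀ : ℝ} (ha : 0 ≤ a) (hc₀ : 0 ≤ c₀)
    (h : ∀ l > 0, ∀ c > c₀, l * x ≤ a + (l * M + l ^ 2 * c / 8)) :
    x ≤ M + Real.sqrt (a * c₀ / 2) := by
  -- The shift by `t` keeps the optimal exponent finite and positive when `a` or `c₀` vanishes, that
  -- is without advice or without queries.
  have key : ∀ t ∈ Set.Ioi (0 : ℝ), x ≤ M + Real.sqrt ((a + t) * (c₀ + t) / 2) := by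
    intro t ht
    have ht : 0 < t := ht
    have hA : 0 < a + t := by linarith
    have hC : 0 < c₀ + t := by linarith
    set r := Real.sqrt ((a + t) * (c₀ + t) / 2) with hr
    have hr0 : 0 < r := Real.sqrt_pos.mpr (by positivity)
    have hr2 : r ^ 2 = (a + t) * (c₀ + t) / 2 := Real.sq_sqrt (by positivity)
    -- This exponent minimises `(a + t) / l + l * (c₀ + t) / 8`: the two terms are equal and sum to
    -- `r`.
    have h1 := h (2 * (a + t) / r) (by positivity) (c₀ + t) (by linarith)
    have e1 : (2 * (a + t) / r) ^ 2 * (c₀ + t) / 8 = a + t := by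
      rw [div_pow, hr2]
      field_simp
      ring
    rw [e1] at h1
    have e2 : 2 * (a + t) / r * (M + r) = 2 * (a + t) / r * M + 2 * (a + t) := by
      field_simp
    refine le_of_mul_le_mul_left (a := 2 * (a + t) / r) ?_ (by positivity)
    linarith
  have ht : Filter.Tendsto (fun t : ℝ => M + Real.sqrt ((a + t) * (c₀ + t) / 2))
      (nhdsWithin 0 (Set.Ioi 0)) (nhds (M + Real.sqrt ((a + 0) * (c₀ + 0) / 2))) := by
    refine Filter.Tendsto.mono_left (Continuous.tendsto ?_ 0) nhdsWithin_le_nhds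
    fun_prop
  simpa using ge_of_tendsto ht (Filter.eventually_of_mem self_mem_nhdsWithin key)

end ExponentialMoment

/-- Reduces randomised algorithms to deterministic ones; nonnegativity makes the series summable. -/
theorem PMF.tsum_toReal_mul_le {β : Type*} (μ : PMF β) {v : β → ℝ} {B : ℝ} (hv0 : ∀ b, 0 ≤ v b)
    (hv : ∀ b, v b ≤ B) : ∑' b, (μ b).toReal * v b ≤ B := by
  have hne : ∑' b, μ b ≠ ⊤ := by rw [μ.tsum_coe]; exact ENNReal.one_ne_top
  have hs : Summable fun b => (μ b).toReal := ENNReal.summable_toReal hne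
  have h1 : ∑' b, (μ b).toReal = 1 := by
    rw [← ENNReal.tsum_toReal_eq fun b => μ.apply_ne_top b, μ.tsum_coe, ENNReal.toReal_one]
  have hle : ∀ b, (μ b).toReal * v b ≤ (μ b).toReal * B := fun b =>
    mul_le_mul_of_nonneg_left (hv b) ENNReal.toReal_nonneg
  have hs2 : Summable fun b => (μ b).toReal * B := hs.mul_right B
  have hs1 : Summable fun b => (μ b).toReal * v b :=
    Summable.of_nonneg_of_le (fun b => mul_nonneg ENNReal.toReal_nonneg (hv0 b)) hle hs2
  refine (hs1.tsum_le_tsum hle hs2).trans (le_of_eq ?_)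
  rw [tsum_mul_right, h1, one_mul]

/-! ### Non-adaptive algorithms: conditioning on inner queries and the cost of advice. -/

namespace PCGame

open Equiv Finset

variable {N : ℕ}

/-- The position of `σ` that a query asks for. -/
def position (G : PCGame N) (d : G.Secret) : G.Query → ZMod N
  | Sum.inl i => i
  | Sum.inr m => G.tr d m

theorem answer_eq {G : PCGame N} (hpost : ∀ d j, G.post d j = j) (σ : Perm (ZMod N))
    (d : G.Secret) (q : G.Query) : G.answer σ d q = σ (G.position d q) := by
  rcases q with i | m
  · rfl
  · exact hpost _ _

/-- The indicator of success of an online algorithm. -/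
noncomputable def OnlineAlg.win {G : PCGame N} {T : ℕ} (A : G.OnlineAlg T) (d : G.Secret)
    (σ : Perm (ZMod N)) : ℝ := if A.succeeds σ d then 1 else 0

theorem OnlineAlg.win_nonneg {G : PCGame N} {T : ℕ} (A : G.OnlineAlg T) (d : G.Secret)
    (σ : Perm (ZMod N)) : 0 ≤ A.win d σ := by
  unfold OnlineAlg.win; split_ifs <;> norm_num

theorem OnlineAlg.win_le_one {G : PCGame N} {T : ℕ} (A : G.OnlineAlg T) (d : G.Secret)
    (σ : Perm (ZMod N)) : A.win d σ ≤ 1 := by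
  unfold OnlineAlg.win; split_ifs <;> norm_num

/-- Two runs with the same answers have the same outcome. -/
theorem OnlineAlg.win_congr {G : PCGame N} (hpost : ∀ d j, G.post d j = j) {T : ℕ}
    (A : G.OnlineAlg T) (d : G.Secret) {σ τ : Perm (ZMod N)}
    (h : ∀ l, σ (G.position d (A.query l)) = τ (G.position d (A.query l))) :
    A.win d σ = A.win d τ := by
  unfold OnlineAlg.win OnlineAlg.succeeds
  simp only [answer_eq hpost, h]

variable [NeZero N]

theorem winProb_eq {G : PCGame N} {T : ℕ} (A : Perm (ZMod N) → G.OnlineAlg T) :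
    G.winProb A = (∑ σ, (∑ d, (A σ).win d σ) / (Fintype.card G.Secret : ℝ)) /
      (Fintype.card (Perm (ZMod N)) : ℝ) := by
  rw [← Finset.sum_div, div_div, mul_comm]
  rfl

theorem winProb_nonneg {G : PCGame N} {T : ℕ} (A : Perm (ZMod N) → G.OnlineAlg T) :
    0 ≤ G.winProb A := by
  rw [winProb_eq]
  exact div_nonneg (Finset.sum_nonneg fun σ _ => div_nonneg
    (Finset.sum_nonneg fun d _ => (A σ).win_nonneg d σ) (Nat.cast_nonneg _)) (Nat.cast_nonneg _)

theorem winProb_le_one {G : PCGame N} {T : ℕ} (A : Perm (ZMod N) → G.OnlineAlg T) :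
    G.winProb A ≤ 1 := by
  rw [winProb_eq]
  refine div_le_one_of_le₀ ?_ (Nat.cast_nonneg _)
  refine (Finset.sum_le_card_nsmul Finset.univ _ 1 fun σ _ => ?_).trans
    (by simp [Finset.card_univ])
  refine div_le_one_of_le₀ ?_ (Nat.cast_nonneg _)
  exact (Finset.sum_le_card_nsmul Finset.univ _ 1 fun d _ => (A σ).win_le_one d σ).trans
    (by simp [Finset.card_univ])

theorem onlineSuccess_pure (G : PCGame N) {T : ℕ} (A : G.OnlineAlg T) :
    G.onlineSuccess (PMF.pure A) = G.winProb fun _ => A := by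
  unfold onlineSuccess
  rw [tsum_eq_single A]
  · simp
  · intro B hB
    simp [PMF.pure_apply, hB]

theorem winProb_le_MaxS (G : PCGame N) {T : ℕ} (A : G.OnlineAlg T) :
    (G.winProb fun _ => A) ≤ G.MaxS T := by
  rw [← onlineSuccess_pure]
  refine le_ciSup (f := fun μ : PMF (G.OnlineAlg T) => G.onlineSuccess μ) ⟨1, ?_⟩ (PMF.pure A)
  rintro _ ⟨μ, rfl⟩
  exact μ.tsum_toReal_mul_le (fun _ => winProb_nonneg _) fun _ => winProb_le_one _

/-- The positions of the inner queries. -/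
noncomputable def OnlineAlg.innerPos {G : PCGame N} {T : ℕ} (A : G.OnlineAlg T) : Finset (ZMod N) :=
  by classical exact Finset.univ.filter fun i => ∃ l, A.query l = Sum.inl i

/-- All positions that are queried when the secret is `d`. -/
noncomputable def OnlineAlg.allPos {G : PCGame N} {T : ℕ} (A : G.OnlineAlg T) (d : G.Secret) :
    Finset (ZMod N) := A.innerPos ∪ Finset.univ.image fun l => G.position d (A.query l)

theorem OnlineAlg.mem_innerPos {G : PCGame N} {T : ℕ} {A : G.OnlineAlg T} {i : ZMod N} :
    i ∈ A.innerPos ↔ ∃ l, A.query l = Sum.inl i := by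
  simp [OnlineAlg.innerPos]

theorem OnlineAlg.win_mul_right {G : PCGame N} (hpost : ∀ d j, G.post d j = j) {T : ℕ}
    (A : G.OnlineAlg T) (d : G.Secret) (h : Perm (ZMod N)) (hh : h ∈ pointFixer (A.allPos d))
    (σ : Perm (ZMod N)) : A.win d (σ * h) = A.win d σ := by
  refine A.win_congr hpost d fun l => ?_
  rw [Perm.mul_apply, mem_pointFixer.mp hh _
    (Finset.mem_union_right _ (Finset.mem_image_of_mem _ (Finset.mem_univ l)))]

/-- A choice of a witness, if there is one. -/
noncomputable def pickPerm (P : Perm (ZMod N) → Prop) : Perm (ZMod N) := by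
  classical exact if h : ∃ ρ, P ρ then h.choose else 1

theorem pickPerm_spec {P : Perm (ZMod N) → Prop} (h : ∃ ρ, P ρ) : P (pickPerm P) := by
  unfold pickPerm
  rw [dif_pos h]
  exact h.choose_spec

/-- The algorithm that relabels the answers so that the inner ones are those of `σ₀`. -/
noncomputable def OnlineAlg.relabel {G : PCGame N} {T : ℕ} (A : G.OnlineAlg T)
    (σ₀ : Perm (ZMod N)) : G.OnlineAlg T where
  numQueries := A.numQueries
  numQueries_le := A.numQueries_le
  query := A.query
  output := fun y => A.output fun l =>
    pickPerm (fun ρ => ∀ l i, A.query l = Sum.inl i → ρ (y l) = σ₀ i) (y l)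

/-- If `r σ` depends only on the values of `σ` on `I` and moves them to those of `σ₀`, then
`r σ * σ` is uniform among the permutations that agree with `σ₀` on `I`. -/
theorem sum_relabel_eq {α : Type*} [Fintype α] [DecidableEq α] {I : Finset α}
    (F : Perm α → ℝ) {r : Perm α → Perm α} {σ₀ : Perm α}
    (hr : ∀ σ, ∀ i ∈ I, r σ (σ i) = σ₀ i)
    (hrinv : ∀ h ∈ pointFixer I, ∀ σ, r (σ * h) = r σ) :
    ∑ σ, F (r σ * σ) = (Fintype.card (Perm α) : ℝ) * fixAvg I F σ₀ := by
  have hconst : ∀ σ, fixAvg I (fun σ => F (r σ * σ)) σ = fixAvg I F σ₀ := by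
    intro σ
    have hk : σ₀⁻¹ * (r σ * σ) ∈ pointFixer I := by
      rw [mem_pointFixer]
      intro q hq
      rw [Perm.mul_apply, Perm.mul_apply, hr σ q hq, Perm.inv_eq_iff_eq]
    have h1 := fixAvg_mul_right hk F σ₀
    rw [mul_inv_cancel_left] at h1
    rw [← h1, fixAvg, fixAvg]
    refine congrArg (· / _) (Finset.sum_congr rfl fun h hh => ?_)
    rw [hrinv h hh, mul_assoc]
  rw [← sum_fixAvg I, Finset.sum_congr rfl fun σ _ => hconst σ, Finset.sum_const,
    nsmul_eq_mul, Finset.card_univ]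

/-- Conditioned on any values at the inner queries, an online algorithm succeeds with probability
at most `MaxS`. -/
theorem OnlineAlg.fixAvg_win_le {G : PCGame N} (hpost : ∀ d j, G.post d j = j) {T : ℕ}
    (A : G.OnlineAlg T) (σ₀ : Perm (ZMod N)) :
    fixAvg A.innerPos (fun σ => (∑ d, A.win d σ) / (Fintype.card G.Secret : ℝ)) σ₀ ≤
      G.MaxS T := by
  set F : Perm (ZMod N) → ℝ := fun σ => (∑ d, A.win d σ) / (Fintype.card G.Secret : ℝ) with hF
  set r : Perm (ZMod N) → Perm (ZMod N) := fun σ =>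
    pickPerm fun ρ => ∀ i ∈ A.innerPos, ρ (σ i) = σ₀ i with hr
  have hrspec : ∀ σ, ∀ i ∈ A.innerPos, r σ (σ i) = σ₀ i := fun σ =>
    pickPerm_spec (P := fun ρ => ∀ i ∈ A.innerPos, ρ (σ i) = σ₀ i)
      ⟨σ₀ * σ⁻¹, fun i _ => by simp⟩
  have hrinv : ∀ h ∈ pointFixer A.innerPos, ∀ σ, r (σ * h) = r σ := by
    intro h hh σ
    simp only [hr]
    congr 1
    funext ρ
    refine propext (forall₂_congr fun i hi => ?_)
    rw [Perm.mul_apply, mem_pointFixer.mp hh i hi]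
  have hwin : ∀ d σ, (A.relabel σ₀).win d σ = A.win d (r σ * σ) := by
    intro d σ
    -- The algorithm sees only the answers, but these determine the predicate on ρ, and `pickPerm`
    -- depends on the predicate alone.
    have e : pickPerm (fun ρ => ∀ l i, A.query l = Sum.inl i →
        ρ (G.answer σ d (A.query l)) = σ₀ i) = r σ := by
      simp only [hr]
      congr 1
      funext ρ
      refine propext ⟨fun H i hi => ?_, fun H l i hl => ?_⟩
      · obtain ⟨l, hl⟩ := OnlineAlg.mem_innerPos.mp hi
        have := H l i hl
        rwa [hl] at this
      · rw [hl]
        exact H i (OnlineAlg.mem_innerPos.mpr ⟨l, hl⟩)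
    unfold OnlineAlg.win OnlineAlg.succeeds
    have e2 : (A.relabel σ₀).output (fun i => G.answer σ d ((A.relabel σ₀).query i)) =
        A.output fun i => G.answer (r σ * σ) d (A.query i) := by
      show A.output (fun l => pickPerm (fun ρ => ∀ l i, A.query l = Sum.inl i →
        ρ (G.answer σ d (A.query l)) = σ₀ i) (G.answer σ d (A.query l))) = _
      rw [e]
      simp only [answer_eq hpost, Perm.mul_apply]
    rw [e2]
  have hn0 : (0 : ℝ) < Fintype.card (Perm (ZMod N)) := by exact_mod_cast Fintype.card_pos
  have hsum := sum_relabel_eq F hrspec hrinv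
  have hle := winProb_le_MaxS G (A.relabel σ₀)
  rw [winProb_eq] at hle
  simp only [hwin] at hle
  have e3 : ∑ σ, (∑ d, A.win d (r σ * σ)) / (Fintype.card G.Secret : ℝ) =
      ∑ σ, F (r σ * σ) := rfl
  rwa [e3, hsum, mul_div_cancel_left₀ _ hn0.ne'] at hle

/-- A weight that depends only on the inner values is a mixture of conditionings on them, each of
which costs nothing. -/
theorem OnlineAlg.sum_mul_win_le {G : PCGame N} (hpost : ∀ d j, G.post d j = j) {T : ℕ}
    (A : G.OnlineAlg T) (g : Perm (ZMod N) → ℝ) (hg : ∀ σ, 0 ≤ g σ)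
    (hgI : ∀ h ∈ pointFixer A.innerPos, ∀ σ, g (σ * h) = g σ) :
    ∑ σ, g σ * ((∑ d, A.win d σ) / (Fintype.card G.Secret : ℝ)) ≤ G.MaxS T * ∑ σ, g σ := by
  have h1 := sum_fixAvg_mul (fun σ => (∑ d, A.win d σ) / (Fintype.card G.Secret : ℝ)) hgI
  rw [Finset.sum_congr rfl fun σ _ => mul_comm (g σ) _, ← h1, Finset.mul_sum]
  exact Finset.sum_le_sum fun σ _ => mul_le_mul_of_nonneg_right (A.fixAvg_win_le hpost σ) (hg σ)

/-- Away from the inner positions only outer queries can hit a point. The constant is a union bound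
over two points and `T` queries, each with probability at most 2/N. -/
theorem OnlineAlg.card_meets_allPos_le {G : PCGame N} (hunif : G.IsUniform ((N : ℝ) / 2)) {T : ℕ}
    (A : G.OnlineAlg T) {i j : ZMod N} (hi : i ∉ A.innerPos) (hj : j ∉ A.innerPos) :
    ((Finset.univ.filter fun d => i ∈ A.allPos d ∨ j ∈ A.allPos d).card : ℝ) ≤
      4 * T / N * (Fintype.card G.Secret : ℝ) := by
  classical
  set k : ℝ := (Fintype.card G.Secret : ℝ) with hk
  have hk0 : 0 ≤ k := Nat.cast_nonneg _
  have hN0 : (0 : ℝ) < N := by exact_mod_cast Nat.pos_of_ne_zero (NeZero.ne N)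
  have hone : ∀ i ∉ A.innerPos, ∀ l,
      ((Finset.univ.filter fun d => G.position d (A.query l) = i).card : ℝ) ≤ 2 / N * k := by
    intro i hi l
    rcases hq : A.query l with i' | m
    · have hne : i' ≠ i := fun e => hi (OnlineAlg.mem_innerPos.mpr ⟨l, e ▸ hq⟩)
      have : (Finset.univ.filter fun d => G.position d (Sum.inl i') = i) = ∅ := by
        refine Finset.filter_eq_empty_iff.mpr fun d _ => ?_
        exact hne
      rw [this]
      simp only [Finset.card_empty, Nat.cast_zero]
      positivity
    · refine (hunif m i).trans (le_of_eq ?_)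
      rw [hk]
      field_simp
  have hsub : (Finset.univ.filter fun d => i ∈ A.allPos d ∨ j ∈ A.allPos d) ⊆
      Finset.univ.biUnion fun l : Fin A.numQueries =>
        (Finset.univ.filter fun d => G.position d (A.query l) = i) ∪
          (Finset.univ.filter fun d => G.position d (A.query l) = j) := by
    intro d hd
    simp only [Finset.mem_filter, Finset.mem_univ, true_and, OnlineAlg.allPos, Finset.mem_union,
      hi, hj, false_or, Finset.mem_image] at hd
    simp only [Finset.mem_biUnion, Finset.mem_union, Finset.mem_filter, Finset.mem_univ, true_and]
    rcases hd with ⟨l, hl⟩ | ⟨l, hl⟩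
    · exact ⟨l, Or.inl hl⟩
    · exact ⟨l, Or.inr hl⟩
  have h1 : ((Finset.univ.filter fun d => i ∈ A.allPos d ∨ j ∈ A.allPos d).card : ℝ) ≤
      ∑ _l : Fin A.numQueries, (2 / N * k + 2 / N * k) := by
    have h2 := (Finset.card_le_card hsub).trans (Finset.card_biUnion_le)
    have h3 : ((Finset.univ.filter fun d => i ∈ A.allPos d ∨ j ∈ A.allPos d).card : ℝ) ≤
      ∑ l : Fin A.numQueries, (((Finset.univ.filter fun d => G.position d (A.query l) = i) ∪
          (Finset.univ.filter fun d => G.position d (A.query l) = j)).card : ℝ) := by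
      exact_mod_cast h2
    refine h3.trans (Finset.sum_le_sum fun l _ => ?_)
    refine le_trans ?_ (add_le_add (hone i hi l) (hone j hj l))
    exact_mod_cast Finset.card_union_le _ _
  refine h1.trans ?_
  rw [Finset.sum_const, Finset.card_univ, Fintype.card_fin, nsmul_eq_mul]
  have hT : (A.numQueries : ℝ) ≤ T := by exact_mod_cast A.numQueries_le
  calc (A.numQueries : ℝ) * (2 / N * k + 2 / N * k) ≤ T * (2 / N * k + 2 / N * k) :=
        mul_le_mul_of_nonneg_right hT (by positivity)
    _ = 4 * T / N * k := by ring

/-- Advice of `S` bits increases the success probability of a non-adaptive algorithm by at most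
`√(2 ln 2 · S T / N)`. -/
theorem winProb_preproc_le {G : PCGame N} [Nonempty G.Secret] (hpost : ∀ d j, G.post d j = j)
    (hunif : G.IsUniform ((N : ℝ) / 2)) {S T : ℕ} (A : G.PreprocAlg S T) :
    (G.winProb fun σ => A.online (A.advice σ)) ≤
      G.MaxS T + Real.sqrt (2 * Real.log 2 * (S : ℝ) * (T : ℝ) / (N : ℝ)) := by
  have hlog : 0 ≤ Real.log 2 := Real.log_nonneg (by norm_num)
  have e : 2 * Real.log 2 * (S : ℝ) * (T : ℝ) / (N : ℝ) =
      (S * Real.log 2) * (4 * T / N) / 2 := by ring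
  rw [e]
  refine le_add_sqrt_of_forall_exponent (by positivity) (by positivity) fun l hl c hc => ?_
  have hc0 : 0 < c := lt_of_le_of_lt (by positivity) hc
  rw [winProb_eq]
  have hcard : Real.log (Fintype.card (Fin S → Bool)) = S * Real.log 2 := by
    simp
  rw [← hcard]
  refine sum_select_le (fun z σ => (∑ d, (A.online z).win d σ) / (Fintype.card G.Secret : ℝ))
    A.advice fun z => ?_
  refine sum_exp_avg_le (Q := (A.online z).allPos) (I := (A.online z).innerPos)
    (OnlineAlg.win_nonneg _) (OnlineAlg.win_le_one _)
    (fun d => Finset.subset_union_left) (OnlineAlg.win_mul_right hpost _)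
    (OnlineAlg.sum_mul_win_le hpost _) hl.le hc0 fun i hi j hj => ?_
  exact (OnlineAlg.card_meets_allPos_le hunif _ hi hj).trans
    (mul_le_mul_of_nonneg_right hc.le (Nat.cast_nonneg _))

end PCGame

/-! ### Collisions and the bound without advice. -/

namespace PCGame

open Equiv Finset

/-- Tuples with the same equality pattern differ by a permutation of the values. -/
theorem exists_perm_comp_eq {α ι : Type*} [Finite α] {x y : ι → α}
    (h : ∀ l l', x l = x l' ↔ y l = y l') : ∃ π : Perm α, ∀ l, π (x l) = y l := by
  classical
  let g : Set.range x → α := fun a => y a.2.choose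
  have hg : Function.Injective g := fun a b hab => by
    have := (h _ _).mpr hab
    rw [a.2.choose_spec, b.2.choose_spec] at this
    exact Subtype.ext this
  obtain ⟨π, hπ⟩ := Equiv.Perm.exists_extending_pair (fun a : Set.range x => (a : α)) g
    Subtype.val_injective hg
  refine ⟨π, fun l => ?_⟩
  have h1 : π (x l) = g ⟨x l, l, rfl⟩ := hπ ⟨x l, l, rfl⟩
  rw [h1]
  exact (h _ _).mp (Exists.choose_spec (⟨l, rfl⟩ : x l ∈ Set.range x))

variable {N : ℕ} [NeZero N]

/-- The secrets for which two queries collide that do not always collide. -/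
noncomputable def OnlineAlg.collisions {G : PCGame N} {T : ℕ} (A : G.OnlineAlg T) :
    Finset G.Secret := by
  classical exact Finset.univ.filter fun d => ∃ l l',
    G.position d (A.query l) = G.position d (A.query l') ∧
      ¬ ∀ d', G.position d' (A.query l) = G.position d' (A.query l')

/-- Union bound over unordered pairs of queries: at most T(T - 1)/2 pairs, each with probability at
most 2/N. -/
theorem OnlineAlg.card_collisions_le {G : PCGame N}
    (hcoll : ∀ q q' : G.Query, (∀ d, G.position d q = G.position d q') ∨
      ((Finset.univ.filter fun d => G.position d q = G.position d q').card : ℝ) ≤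
        2 / N * (Fintype.card G.Secret : ℝ)) {T : ℕ} (A : G.OnlineAlg T) :
    (A.collisions.card : ℝ) ≤ (T : ℝ) ^ 2 / N * (Fintype.card G.Secret : ℝ) := by
  classical
  set k : ℝ := (Fintype.card G.Secret : ℝ) with hk
  have hk0 : 0 ≤ k := Nat.cast_nonneg _
  have hN0 : (0 : ℝ) < N := by exact_mod_cast Nat.pos_of_ne_zero (NeZero.ne N)
  let C : Fin A.numQueries → Fin A.numQueries → Finset G.Secret := fun l l' =>
    if ∀ d, G.position d (A.query l) = G.position d (A.query l') then ∅ else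
      Finset.univ.filter fun d => G.position d (A.query l) = G.position d (A.query l')
  have hC : ∀ l l', ((C l l').card : ℝ) ≤ 2 / N * k := by
    intro l l'
    simp only [C]
    split_ifs with h
    · simp only [Finset.card_empty, Nat.cast_zero]
      positivity
    · exact (hcoll _ _).resolve_left h
  have hsub : A.collisions ⊆ Finset.univ.biUnion fun l' => (Finset.Iio l').biUnion fun l =>
      C l l' := by
    intro d hd
    simp only [OnlineAlg.collisions, Finset.mem_filter, Finset.mem_univ, true_and] at hd
    obtain ⟨l, l', h1, h2⟩ := hd
    simp only [Finset.mem_biUnion, Finset.mem_univ, true_and, Finset.mem_Iio]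
    rcases lt_trichotomy l l' with hlt | rfl | hlt
    · exact ⟨l', l, hlt, by simp only [C, if_neg h2]; simpa using h1⟩
    · exact absurd (fun _ => rfl) h2
    · have h2' : ¬ ∀ d', G.position d' (A.query l') = G.position d' (A.query l) :=
        fun h => h2 fun d' => (h d').symm
      exact ⟨l, l', hlt, by simp only [C, if_neg h2']; simpa using h1.symm⟩
  have h1 : (A.collisions.card : ℝ) ≤ ∑ l' : Fin A.numQueries, (l' : ℕ) * (2 / N * k) := by
    have h2 := (Finset.card_le_card hsub).trans Finset.card_biUnion_le
    have h3 : (A.collisions.card : ℝ) ≤ ∑ l' : Fin A.numQueries,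
        (((Finset.Iio l').biUnion fun l => C l l').card : ℝ) := by exact_mod_cast h2
    refine h3.trans (Finset.sum_le_sum fun l' _ => ?_)
    have h4 : (((Finset.Iio l').biUnion fun l => C l l').card : ℝ) ≤
        ∑ l ∈ Finset.Iio l', ((C l l').card : ℝ) := by exact_mod_cast Finset.card_biUnion_le
    refine h4.trans ((Finset.sum_le_card_nsmul _ _ _ fun l _ => hC l l').trans (le_of_eq ?_))
    rw [Fin.card_Iio, nsmul_eq_mul]
  rw [← Finset.sum_mul, Fin.sum_univ_eq_sum_range (fun l => (l : ℝ))] at h1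
  have h2 : (∑ l ∈ Finset.range A.numQueries, (l : ℝ)) * 2 ≤ (T : ℝ) ^ 2 := by
    have e := Finset.sum_range_id_mul_two A.numQueries
    have h3 : (∑ l ∈ Finset.range A.numQueries, l) * 2 ≤ T ^ 2 := by
      rw [e, sq]
      exact Nat.mul_le_mul A.numQueries_le ((Nat.sub_le _ _).trans A.numQueries_le)
    have h4 := (Nat.cast_le (α := ℝ)).mpr h3
    push_cast at h4
    exact h4
  calc (A.collisions.card : ℝ)
      ≤ (∑ l ∈ Finset.range A.numQueries, (l : ℝ)) * (2 / N * k) := h1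
    _ = ((∑ l ∈ Finset.range A.numQueries, (l : ℝ)) * 2) * (k / N) := by ring
    _ ≤ (T : ℝ) ^ 2 * (k / N) := mul_le_mul_of_nonneg_right h2 (by positivity)
    _ = (T : ℝ) ^ 2 / N * k := by ring

/-- In a game where a balanced bit of the secret has to be guessed, a non-adaptive algorithm
learns nothing unless a nontrivial collision occurs. -/
theorem winProb_le_half_add {G : PCGame N} [Nonempty G.Secret] (hpost : ∀ d j, G.post d j = j)
    (dec : G.Output → Bool) (bit : G.Secret → Bool)
    (hsuc : ∀ d v, G.suc d v = (dec v == bit d))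
    (hbal : ∀ b, ((Finset.univ.filter fun d => bit d = b).card : ℝ) =
      (Fintype.card G.Secret : ℝ) / 2)
    (hcoll : ∀ q q' : G.Query, (∀ d, G.position d q = G.position d q') ∨
      ((Finset.univ.filter fun d => G.position d q = G.position d q').card : ℝ) ≤
        2 / N * (Fintype.card G.Secret : ℝ)) {T : ℕ} (A : G.OnlineAlg T) :
    (G.winProb fun _ => A) ≤ 1 / 2 + (T : ℝ) ^ 2 / N := by
  classical
  set k : ℝ := (Fintype.card G.Secret : ℝ) with hk
  have hk0 : 0 < k := by rw [hk]; exact_mod_cast Fintype.card_pos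
  set n : ℝ := (Fintype.card (Perm (ZMod N)) : ℝ) with hn
  have hn0 : 0 < n := by rw [hn]; exact_mod_cast Fintype.card_pos
  let v : G.Secret → Bool → ℝ := fun d b => ∑ σ : Perm (ZMod N),
    if dec (A.output fun l => σ (G.position d (A.query l))) = b then 1 else 0
  have hv0 : ∀ d b, 0 ≤ v d b := fun d b =>
    Finset.sum_nonneg fun σ _ => by split_ifs <;> norm_num
  have hvsum : ∀ d, v d false + v d true = n := by
    intro d
    simp only [v]
    rw [← Finset.sum_add_distrib]
    have : ∀ σ : Perm (ZMod N),
        ((if dec (A.output fun l => σ (G.position d (A.query l))) = false then (1 : ℝ) else 0) +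
        if dec (A.output fun l => σ (G.position d (A.query l))) = true then 1 else 0) = 1 := by
      intro σ
      cases dec (A.output fun l => σ (G.position d (A.query l))) <;> simp
    rw [Finset.sum_congr rfl fun σ _ => this σ]
    simp [hn]
  have hvn : ∀ d b, v d b ≤ n := by
    intro d b
    have := hvsum d
    cases b
    · linarith [hv0 d true]
    · linarith [hv0 d false]
  have hwin : ∀ d, ∑ σ, A.win d σ = v d (bit d) := by
    intro d
    refine Finset.sum_congr rfl fun σ _ => ?_
    unfold OnlineAlg.win OnlineAlg.succeeds
    simp only [answer_eq hpost, hsuc, beq_iff_eq]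
  have hgood : ∀ d ∉ A.collisions, ∀ d' ∉ A.collisions, ∀ b, v d b = v d' b := by
    intro d hd d' hd' b
    have imp : ∀ d ∉ A.collisions, ∀ d' l l',
        G.position d (A.query l) = G.position d (A.query l') →
        G.position d' (A.query l) = G.position d' (A.query l') := by
      intro d hd d' l l' h
      by_contra hne
      refine hd ?_
      simp only [OnlineAlg.collisions, Finset.mem_filter, Finset.mem_univ, true_and]
      exact ⟨l, l', h, fun H => hne (H d')⟩
    -- Off the collisions all secrets produce the same equality pattern, so right translation of σ
    -- by `π` matches the answers for the two secrets.
    obtain ⟨π, hπ⟩ := exists_perm_comp_eq (x := fun l => G.position d (A.query l))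
      (y := fun l => G.position d' (A.query l))
      fun l l' => ⟨imp d hd d' l l', imp d' hd' d l l'⟩
    have h1 := sum_mul_right_perm (fun σ : Perm (ZMod N) =>
      if dec (A.output fun l => σ (G.position d (A.query l))) = b then (1 : ℝ) else 0) π
    simp only [v]
    rw [← h1]
    simp only [Perm.mul_apply, hπ]
  have hbad := A.card_collisions_le hcoll
  have htot : ∑ d, v d (bit d) ≤ k / 2 * n + (A.collisions.card : ℝ) * n := by
    -- Colliding secrets are counted as wins. On the others the output law is that of one fixed
    -- `d₀`, and the balanced bit makes guessing worth one half.
    rw [← Finset.sum_filter_add_sum_filter_not Finset.univ (fun d => d ∈ A.collisions)]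
    rw [add_comm]
    refine add_le_add ?_ ?_
    · by_cases hex : ∃ d₀, d₀ ∉ A.collisions
      · obtain ⟨d₀, hd₀⟩ := hex
        have h1 : ∑ d ∈ Finset.univ.filter (fun d => ¬ d ∈ A.collisions), v d (bit d) =
            ∑ d ∈ Finset.univ.filter (fun d => ¬ d ∈ A.collisions), v d₀ (bit d) :=
          Finset.sum_congr rfl fun d hd => hgood d (Finset.mem_filter.mp hd).2 d₀ hd₀ _
        have h2 : ∑ d ∈ Finset.univ.filter (fun d => ¬ d ∈ A.collisions), v d₀ (bit d) ≤
            ∑ d, v d₀ (bit d) :=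
          Finset.sum_le_sum_of_subset_of_nonneg (Finset.filter_subset _ _)
            fun d _ _ => hv0 _ _
        have h3 : ∑ d, v d₀ (bit d) = ∑ b, ∑ d ∈ Finset.univ.filter (fun d => bit d = b),
            v d₀ (bit d) := (Finset.sum_fiberwise _ _ _).symm
        have h4 : ∀ b, ∑ d ∈ Finset.univ.filter (fun d => bit d = b), v d₀ (bit d) =
            k / 2 * v d₀ b := by
          intro b
          rw [Finset.sum_congr rfl fun d hd => by rw [(Finset.mem_filter.mp hd).2],
            Finset.sum_const, nsmul_eq_mul, hbal]
        rw [h1]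
        refine h2.trans (le_of_eq ?_)
        rw [h3, Finset.sum_congr rfl fun b _ => h4 b, ← Finset.mul_sum, Fintype.sum_bool,
          add_comm, hvsum]
      · push Not at hex
        rw [Finset.filter_eq_empty_iff.mpr fun d _ => not_not.mpr (hex d), Finset.sum_empty]
        positivity
    · refine (Finset.sum_le_card_nsmul _ _ n fun d _ => hvn d _).trans (le_of_eq ?_)
      rw [nsmul_eq_mul]
      simp
  have h1 : (G.winProb fun _ => A) = (∑ d, v d (bit d)) / k / n := by
    rw [winProb_eq, ← Finset.sum_div, Finset.sum_comm, Finset.sum_congr rfl fun d _ => hwin d]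
  rw [h1, div_le_iff₀ hn0, div_le_iff₀ hk0]
  have h2 := mul_le_mul_of_nonneg_right hbad hn0.le
  nlinarith

theorem MaxS_le_half_add {G : PCGame N} [Nonempty G.Secret] (hpost : ∀ d j, G.post d j = j)
    (dec : G.Output → Bool) (bit : G.Secret → Bool)
    (hsuc : ∀ d v, G.suc d v = (dec v == bit d))
    (hbal : ∀ b, ((Finset.univ.filter fun d => bit d = b).card : ℝ) =
      (Fintype.card G.Secret : ℝ) / 2)
    (hcoll : ∀ q q' : G.Query, (∀ d, G.position d q = G.position d q') ∨
      ((Finset.univ.filter fun d => G.position d q = G.position d q').card : ℝ) ≤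
        2 / N * (Fintype.card G.Secret : ℝ)) (T : ℕ) :
    G.MaxS T ≤ 1 / 2 + (T : ℝ) ^ 2 / N := by
  unfold MaxS
  refine Real.iSup_le (fun μ => ?_) (by positivity)
  exact μ.tsum_toReal_mul_le (fun _ => winProb_nonneg _) fun A =>
    winProb_le_half_add hpost dec bit hsuc hbal hcoll A

end PCGame

/-! ### Counting solutions over the prime field. -/

section CountSolutions

open Finset

variable {N : ℕ} [Fact N.Prime]

theorem card_linear_le_one {c : ZMod N} (hc : c ≠ 0) (e j : ZMod N) :
    (Finset.univ.filter fun x : ZMod N => c * x + e = j).card ≤ 1 := by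
  refine Finset.card_le_one.mpr fun x hx y hy => ?_
  simp only [Finset.mem_filter, Finset.mem_univ, true_and] at hx hy
  exact mul_left_cancel₀ hc (add_right_cancel (hx.trans hy.symm))

theorem card_filter_le_one_of_linear {p : ZMod N → Prop} [DecidablePred p] {c : ZMod N}
    (hc : c ≠ 0) (e j : ZMod N) (hp : ∀ x, p x → c * x + e = j) :
    (Finset.univ.filter p).card ≤ 1 :=
  (Finset.card_le_card (Finset.monotone_filter_right _ fun x _ hx => hp x hx)).trans
    (card_linear_le_one hc e j)

/-- Divided differences at three distinct roots kill first `a₂`, then `a₁`. -/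
theorem card_quadratic_le_two {a₁ a₂ : ZMod N} (h : ¬(a₁ = 0 ∧ a₂ = 0)) (b j : ZMod N) :
    (Finset.univ.filter fun x : ZMod N => a₁ * x + a₂ * x ^ 2 + b = j).card ≤ 2 := by
  by_contra hcon
  obtain ⟨x, hx, y, hy, z, hz, hxy, hxz, hyz⟩ := Finset.two_lt_card.mp (not_le.mp hcon)
  simp only [Finset.mem_filter, Finset.mem_univ, true_and] at hx hy hz
  have e1 : (x - y) * (a₁ + a₂ * (x + y)) = 0 := by linear_combination hx - hy
  have e2 : (x - z) * (a₁ + a₂ * (x + z)) = 0 := by linear_combination hx - hz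
  have f1 := (mul_eq_zero.mp e1).resolve_left (sub_ne_zero.mpr hxy)
  have f2 := (mul_eq_zero.mp e2).resolve_left (sub_ne_zero.mpr hxz)
  have f3 : a₂ * (y - z) = 0 := by linear_combination f1 - f2
  have g2 := (mul_eq_zero.mp f3).resolve_right (sub_ne_zero.mpr hyz)
  rw [g2, zero_mul, add_zero] at f1
  exact h ⟨f1, g2⟩

theorem sum_card_fiber_le {β : Type*} [Fintype β] {p : β → ZMod N → Prop} [∀ x, DecidablePred (p x)]
    {n : ℕ} (h : ∀ x, (Finset.univ.filter (p x)).card ≤ n) :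
    ∑ x, ∑ y, (if p x y then 1 else 0) ≤ Fintype.card β * n := by
  refine (Finset.sum_le_card_nsmul Finset.univ _ n fun x _ => ?_).trans
    (by simp [Finset.card_univ])
  rw [← Finset.card_filter]
  exact h x

theorem sum_linear_two_le {a₁ a₂ : ZMod N} (h : ¬(a₁ = 0 ∧ a₂ = 0)) (b j : ZMod N) :
    ∑ x : ZMod N, ∑ y : ZMod N, (if a₁ * x + a₂ * y + b = j then 1 else 0) ≤ N := by
  by_cases h2 : a₂ = 0
  · rw [Finset.sum_comm]
    refine (sum_card_fiber_le (n := 1) fun y => ?_).trans (by simp [ZMod.card])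
    exact card_filter_le_one_of_linear (fun h1 => h ⟨h1, h2⟩) (a₂ * y + b) j
      fun x hx => by rw [← hx]; ring
  · refine (sum_card_fiber_le (n := 1) fun x => ?_).trans (by simp [ZMod.card])
    exact card_filter_le_one_of_linear h2 (a₁ * x + b) j fun y hy => by rw [← hy]; ring

theorem sum_linear_three_le {a₁ a₂ a₃ : ZMod N} (h : ¬(a₁ = 0 ∧ a₂ = 0 ∧ a₃ = 0))
    (b j : ZMod N) :
    ∑ x : ZMod N, ∑ y : ZMod N, ∑ z : ZMod N,
      (if a₁ * x + a₂ * y + a₃ * z + b = j then 1 else 0) ≤ N * N := by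
  by_cases h1 : a₁ = 0
  · have h' : ¬(a₂ = 0 ∧ a₃ = 0) := fun H => h ⟨h1, H⟩
    refine (Finset.sum_le_card_nsmul Finset.univ _ N fun x _ => ?_).trans
      (by simp [Finset.card_univ, ZMod.card])
    have := sum_linear_two_le h' b j
    simpa [h1] using this
  · have : ∀ x y : ZMod N, ∑ z : ZMod N,
        (if a₁ * x + a₂ * y + a₃ * z + b = j then 1 else 0) =
        ∑ z : ZMod N, (if a₁ * x + (a₂ * y + (a₃ * z + b)) = j then 1 else 0) := by
      intro x y
      simp only [add_assoc]
    simp only [this]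
    rw [Finset.sum_comm]
    refine (Finset.sum_le_card_nsmul Finset.univ _ N fun y _ => ?_).trans
      (by simp [Finset.card_univ, ZMod.card])
    rw [Finset.sum_comm]
    refine (sum_card_fiber_le (n := 1) fun z => ?_).trans (by simp [ZMod.card])
    exact card_linear_le_one h1 _ j

/-- For fixed `x` the equation is linear in `y` with slope `a₃ * x + a₂`. Unless `a₂ = a₃ = 0`, the
slope vanishes for at most one `x`, and that `x` contributes at most `N` solutions. -/
theorem sum_bilinear_le {a₁ a₂ a₃ : ZMod N} (h : ¬(a₁ = 0 ∧ a₂ = 0 ∧ a₃ = 0))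
    (b j : ZMod N) :
    ∑ x : ZMod N, ∑ y : ZMod N,
      (if a₁ * x + a₂ * y + a₃ * (x * y) + b = j then 1 else 0) ≤ 2 * N := by
  by_cases h23 : a₂ = 0 ∧ a₃ = 0
  · have h1 : ¬(a₁ = 0 ∧ a₂ = 0) := fun H => h ⟨H.1, H.2, h23.2⟩
    have := sum_linear_two_le h1 b j
    simp only [h23.2, zero_mul, add_zero] at this ⊢
    omega
  · have hy : ∀ x : ZMod N, ∑ y : ZMod N,
        (if a₁ * x + a₂ * y + a₃ * (x * y) + b = j then 1 else 0) ≤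
        1 + N * (if a₃ * x + a₂ = 0 then 1 else 0) := by
      intro x
      split_ifs with hx
      · refine (Finset.sum_le_card_nsmul Finset.univ _ 1 fun y _ => ?_).trans ?_
        · split_ifs <;> simp
        · simp [Finset.card_univ, ZMod.card]
      · rw [← Finset.card_filter]
        refine (card_filter_le_one_of_linear hx (a₁ * x + b) j fun y hy => ?_).trans (by omega)
        rw [← hy]
        ring
    have hx : ∑ x : ZMod N, (if a₃ * x + a₂ = 0 then 1 else 0) ≤ 1 := by
      by_cases h3 : a₃ = 0
      · have h2 : a₂ ≠ 0 := fun h2 => h23 ⟨h2, h3⟩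
        simp [h3, h2]
      · rw [← Finset.card_filter]
        exact card_linear_le_one h3 a₂ 0
    refine (Finset.sum_le_sum fun x _ => hy x).trans ?_
    rw [Finset.sum_add_distrib, ← Finset.mul_sum]
    have := Nat.mul_le_mul_left N hx
    simp only [Finset.sum_const, Finset.card_univ, ZMod.card, smul_eq_mul, mul_one] at this ⊢
    omega

theorem sum_quadratic_le {a₁ a₂ : ZMod N} (h : ¬(a₁ = 0 ∧ a₂ = 0)) (b j : ZMod N) :
    ∑ x : ZMod N, (if a₁ * x + a₂ * x ^ 2 + b = j then 1 else 0) ≤ 2 := by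
  rw [← Finset.card_filter]
  exact card_quadratic_le_two h b j

end CountSolutions

/-! ### Uniformity, collisions and balance for DDH and sqDDH. -/

section Games

open Finset

/-- Any collision that is neither certain nor impossible forces some outer query to take a
prescribed value, so uniformity bounds it. -/
theorem PCGame.collision_of_difference {N : ℕ} [NeZero N] {G : PCGame N}
    (hunif : G.IsUniform ((N : ℝ) / 2))
    (hdiff : ∀ m m' : G.OuterQuery, (∀ d, G.tr d m = G.tr d m') ∨ (∀ d, G.tr d m ≠ G.tr d m') ∨
      ∃ m'', ∀ d, G.tr d m = G.tr d m' → G.tr d m'' = 0) (q q' : G.Query) :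
    (∀ d, G.position d q = G.position d q') ∨
      ((Finset.univ.filter fun d => G.position d q = G.position d q').card : ℝ) ≤
        2 / N * (Fintype.card G.Secret : ℝ) := by
  have hu : ∀ (m : G.OuterQuery) (j : ZMod N) (s : Finset G.Secret),
      (∀ d ∈ s, G.tr d m = j) → (s.card : ℝ) ≤ 2 / N * (Fintype.card G.Secret : ℝ) := by
    intro m j s hs
    have h1 : s.card ≤ (Finset.univ.filter fun d : G.Secret => G.tr d m = j).card :=
      Finset.card_le_card fun d hd => by simpa using hs d hd
    have h2 : (s.card : ℝ) ≤ ((Finset.univ.filter fun d : G.Secret => G.tr d m = j).card : ℝ) := by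
      exact_mod_cast h1
    refine h2.trans ((hunif m j).trans (le_of_eq ?_))
    rw [div_div_eq_mul_div]
    ring
  have h0 : ∀ s : Finset G.Secret, (∀ d, d ∉ s) →
      (s.card : ℝ) ≤ 2 / N * (Fintype.card G.Secret : ℝ) := by
    intro s hs
    rw [Finset.eq_empty_of_forall_notMem hs, Finset.card_empty, Nat.cast_zero]
    positivity
  rcases q with i | m <;> rcases q' with i' | m'
  · by_cases h : i = i'
    · exact Or.inl fun d => h
    · exact Or.inr (h0 _ fun d hd => h (Finset.mem_filter.mp hd).2)
  · exact Or.inr (hu m' i _ fun d hd => (Finset.mem_filter.mp hd).2.symm)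
  · exact Or.inr (hu m i' _ fun d hd => (Finset.mem_filter.mp hd).2)
  · rcases hdiff m m' with h | h | ⟨m'', h⟩
    · exact Or.inl h
    · exact Or.inr (h0 _ fun d hd => h d (Finset.mem_filter.mp hd).2)
    · exact Or.inr (hu m'' 0 _ fun d hd => h d (Finset.mem_filter.mp hd).2)

variable (N : ℕ) [Fact N.Prime]

theorem card_ddhGame_secret : Fintype.card (ddhGame N).Secret = N * (N * (N * 2)) := by
  show Fintype.card (ZMod N × ZMod N × ZMod N × Bool) = _
  simp [ZMod.card]

theorem card_sqddhGame_secret : Fintype.card (sqddhGame N).Secret = N * (N * 2) := by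
  show Fintype.card (ZMod N × ZMod N × Bool) = _
  simp [ZMod.card]

theorem ddhGame_isUniform : (ddhGame N).IsUniform ((N : ℝ) / 2) := by
  rintro ⟨⟨a₁, a₂, a₃, b⟩, hm⟩ j
  have hN0 : (0 : ℝ) < N := by exact_mod_cast (Fact.out : N.Prime).pos
  rw [card_ddhGame_secret]
  have h1 : (Finset.univ.filter fun d : (ddhGame N).Secret =>
      (ddhGame N).tr d ⟨(a₁, a₂, a₃, b), hm⟩ = j).card =
      (∑ x : ZMod N, ∑ y : ZMod N, ∑ _z : ZMod N,
        (if a₁ * x + a₂ * y + a₃ * (x * y) + b = j then 1 else 0)) +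
      ∑ x : ZMod N, ∑ y : ZMod N, ∑ z : ZMod N,
        (if a₁ * x + a₂ * y + a₃ * z + b = j then 1 else 0) := by
    rw [Finset.card_filter]
    change ∑ d : ZMod N × ZMod N × ZMod N × Bool, _ = _
    simp only [Fintype.sum_prod_type, Fintype.sum_bool, Finset.sum_add_distrib]
    rfl
  have h2 := sum_linear_three_le hm b j
  have h3 : ∑ x : ZMod N, ∑ y : ZMod N, ∑ _z : ZMod N,
      (if a₁ * x + a₂ * y + a₃ * (x * y) + b = j then 1 else 0) ≤ N * (2 * N) := by
    simp only [Finset.sum_const, Finset.card_univ, ZMod.card, ← Finset.smul_sum]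
    exact Nat.mul_le_mul_left N (sum_bilinear_le hm b j)
  -- The two values of `k` contribute N² and 2N² solutions at most; the 4N² allowed by
  -- (N/2)-uniformity leaves room.
  have h4 : (Finset.univ.filter fun d : (ddhGame N).Secret =>
      (ddhGame N).tr d ⟨(a₁, a₂, a₃, b), hm⟩ = j).card ≤ 4 * (N * N) := by
    rw [h1]
    nlinarith
  rw [le_div_iff₀ (by positivity)]
  have h5 := (Nat.cast_le (α := ℝ)).mpr h4
  push_cast at h5 ⊢
  nlinarith

theorem sqddhGame_isUniform : (sqddhGame N).IsUniform ((N : ℝ) / 2) := by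
  rintro ⟨⟨a₁, a₂, b⟩, hm⟩ j
  have hN0 : (0 : ℝ) < N := by exact_mod_cast (Fact.out : N.Prime).pos
  rw [card_sqddhGame_secret]
  have h1 : (Finset.univ.filter fun d : (sqddhGame N).Secret =>
      (sqddhGame N).tr d ⟨(a₁, a₂, b), hm⟩ = j).card =
      (∑ x : ZMod N, ∑ _y : ZMod N, (if a₁ * x + a₂ * x ^ 2 + b = j then 1 else 0)) +
      ∑ x : ZMod N, ∑ y : ZMod N, (if a₁ * x + a₂ * y + b = j then 1 else 0) := by
    rw [Finset.card_filter]
    change ∑ d : ZMod N × ZMod N × Bool, _ = _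
    simp only [Fintype.sum_prod_type, Fintype.sum_bool, Finset.sum_add_distrib]
    rfl
  have h2 := sum_linear_two_le (a₁ := a₁) (a₂ := a₂) hm b j
  have h3 : ∑ x : ZMod N, ∑ _y : ZMod N,
      (if a₁ * x + a₂ * x ^ 2 + b = j then 1 else 0) ≤ N * 2 := by
    simp only [Finset.sum_const, Finset.card_univ, ZMod.card, ← Finset.smul_sum]
    exact Nat.mul_le_mul_left N (sum_quadratic_le hm b j)
  have h4 : (Finset.univ.filter fun d : (sqddhGame N).Secret =>
      (sqddhGame N).tr d ⟨(a₁, a₂, b), hm⟩ = j).card ≤ 4 * N := by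
    rw [h1]
    omega
  rw [le_div_iff₀ (by positivity)]
  have h5 := (Nat.cast_le (α := ℝ)).mpr h4
  push_cast at h5 ⊢
  nlinarith

theorem ddhGame_difference (m m' : (ddhGame N).OuterQuery) :
    (∀ d, (ddhGame N).tr d m = (ddhGame N).tr d m') ∨
    (∀ d, (ddhGame N).tr d m ≠ (ddhGame N).tr d m') ∨
      ∃ m'', ∀ d, (ddhGame N).tr d m = (ddhGame N).tr d m' → (ddhGame N).tr d m'' = 0 := by
  obtain ⟨⟨a₁, a₂, a₃, b⟩, hm⟩ := m
  obtain ⟨⟨a₁', a₂', a₃', b'⟩, hm'⟩ := m'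
  by_cases h : a₁ - a₁' = 0 ∧ a₂ - a₂' = 0 ∧ a₃ - a₃' = 0
  · obtain ⟨h1, h2, h3⟩ := h
    obtain rfl := sub_eq_zero.mp h1
    obtain rfl := sub_eq_zero.mp h2
    obtain rfl := sub_eq_zero.mp h3
    by_cases hb : b = b'
    · subst hb
      exact Or.inl fun _ => rfl
    · refine Or.inr (Or.inl ?_)
      rintro ⟨d₁, d₂, d₃, _ | _⟩ h <;> exact hb (add_left_cancel h)
  -- Both branches of `tr` are linear in the query, so the coefficientwise difference is the
  -- witness; `h` makes it a legal outer query.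
  · refine Or.inr (Or.inr ⟨⟨(a₁ - a₁', a₂ - a₂', a₃ - a₃', b - b'), h⟩, ?_⟩)
    rintro ⟨d₁, d₂, d₃, _ | _⟩ h
    · change a₁ * d₁ + a₂ * d₂ + a₃ * d₃ + b = a₁' * d₁ + a₂' * d₂ + a₃' * d₃ + b' at h
      change (a₁ - a₁') * d₁ + (a₂ - a₂') * d₂ + (a₃ - a₃') * d₃ + (b - b') = 0
      linear_combination h
    · change a₁ * d₁ + a₂ * d₂ + a₃ * (d₁ * d₂) + b =
        a₁' * d₁ + a₂' * d₂ + a₃' * (d₁ * d₂) + b' at h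
      change (a₁ - a₁') * d₁ + (a₂ - a₂') * d₂ + (a₃ - a₃') * (d₁ * d₂) + (b - b') = 0
      linear_combination h

theorem sqddhGame_difference (m m' : (sqddhGame N).OuterQuery) :
    (∀ d, (sqddhGame N).tr d m = (sqddhGame N).tr d m') ∨
    (∀ d, (sqddhGame N).tr d m ≠ (sqddhGame N).tr d m') ∨
      ∃ m'', ∀ d, (sqddhGame N).tr d m = (sqddhGame N).tr d m' →
        (sqddhGame N).tr d m'' = 0 := by
  obtain ⟨⟨a₁, a₂, b⟩, hm⟩ := m
  obtain ⟨⟨a₁', a₂', b'⟩, hm'⟩ := m'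
  by_cases h : a₁ - a₁' = 0 ∧ a₂ - a₂' = 0
  · obtain ⟨h1, h2⟩ := h
    obtain rfl := sub_eq_zero.mp h1
    obtain rfl := sub_eq_zero.mp h2
    by_cases hb : b = b'
    · subst hb
      exact Or.inl fun _ => rfl
    · refine Or.inr (Or.inl ?_)
      rintro ⟨d₁, d₂, _ | _⟩ h <;> exact hb (add_left_cancel h)
  · refine Or.inr (Or.inr ⟨⟨(a₁ - a₁', a₂ - a₂', b - b'), h⟩, ?_⟩)
    rintro ⟨d₁, d₂, _ | _⟩ h
    · change a₁ * d₁ + a₂ * d₂ + b = a₁' * d₁ + a₂' * d₂ + b' at h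
      change (a₁ - a₁') * d₁ + (a₂ - a₂') * d₂ + (b - b') = 0
      linear_combination h
    · change a₁ * d₁ + a₂ * d₁ ^ 2 + b = a₁' * d₁ + a₂' * d₁ ^ 2 + b' at h
      change (a₁ - a₁') * d₁ + (a₂ - a₂') * d₁ ^ 2 + (b - b') = 0
      linear_combination h

theorem ddhGame_MaxS_le (T : ℕ) : (ddhGame N).MaxS T ≤ 1 / 2 + (T : ℝ) ^ 2 / N := by
  have : Nonempty (ddhGame N).Secret := ⟨((0, 0, 0, false) : ZMod N × ZMod N × ZMod N × Bool)⟩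
  refine PCGame.MaxS_le_half_add (fun _ _ => rfl) (fun v : Bool => v)
    (fun d : ZMod N × ZMod N × ZMod N × Bool => d.2.2.2) (fun _ _ => rfl) (fun b => ?_)
    (PCGame.collision_of_difference (ddhGame_isUniform N) (ddhGame_difference N)) T
  rw [card_ddhGame_secret]
  have : (Finset.univ.filter fun d : (ddhGame N).Secret =>
      (fun d : ZMod N × ZMod N × ZMod N × Bool => d.2.2.2) d = b).card = N * (N * N) := by
    rw [Finset.card_filter]
    change ∑ d : ZMod N × ZMod N × ZMod N × Bool, (if d.2.2.2 = b then 1 else 0) = _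
    simp only [Fintype.sum_prod_type]
    cases b <;> simp [ZMod.card]
  rw [this]
  push_cast
  ring

theorem sqddhGame_MaxS_le (T : ℕ) : (sqddhGame N).MaxS T ≤ 1 / 2 + (T : ℝ) ^ 2 / N := by
  have : Nonempty (sqddhGame N).Secret := ⟨((0, 0, false) : ZMod N × ZMod N × Bool)⟩
  refine PCGame.MaxS_le_half_add (fun _ _ => rfl) (fun v : Bool => v)
    (fun d : ZMod N × ZMod N × Bool => d.2.2) (fun _ _ => rfl) (fun b => ?_)
    (PCGame.collision_of_difference (sqddhGame_isUniform N) (sqddhGame_difference N)) T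
  rw [card_sqddhGame_secret]
  have : (Finset.univ.filter fun d : (sqddhGame N).Secret =>
      (fun d : ZMod N × ZMod N × Bool => d.2.2) d = b).card = N * N := by
    rw [Finset.card_filter]
    change ∑ d : ZMod N × ZMod N × Bool, (if d.2.2 = b then 1 else 0) = _
    simp only [Fintype.sum_prod_type]
    cases b <;> simp [ZMod.card]
  rw [this]
  push_cast
  ring

theorem PCGame.preprocSuccess_le {N : ℕ} [NeZero N] {G : PCGame N} [Nonempty G.Secret]
    (hpost : ∀ d j, G.post d j = j) (hunif : G.IsUniform ((N : ℝ) / 2)) {S T : ℕ}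
    (A : PMF (G.PreprocAlg S T)) :
    G.preprocSuccess A ≤
      G.MaxS T + Real.sqrt (2 * Real.log 2 * (S : ℝ) * (T : ℝ) / (N : ℝ)) :=
  A.tsum_toReal_mul_le (fun _ => winProb_nonneg _) fun _ => winProb_preproc_le hpost hunif _

end Games

theorem theorem2 (N : ℕ) [Fact N.Prime] (G : PCGame N)
    (hG : G = ddhGame N ∨ G = sqddhGame N) (S T : ℕ) :
    G.IsUniform ((N : ℝ) / 2) ∧
    (∀ A : PMF (G.PreprocAlg S T),
      G.preprocSuccess A ≤
        G.MaxS T + Real.sqrt (2 * Real.log 2 * (S : ℝ) * (T : ℝ) / (N : ℝ))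
          + (T : ℝ) ^ 2 / (N : ℝ)) ∧
    G.MaxS T + Real.sqrt (2 * Real.log 2 * (S : ℝ) * (T : ℝ) / (N : ℝ))
        + (T : ℝ) ^ 2 / (N : ℝ) ≤
      1 / 2 + 2 * (T : ℝ) ^ 2 / (N : ℝ)
        + Real.sqrt (2 * Real.log 2 * (S : ℝ) * (T : ℝ) / (N : ℝ)) := by
  obtain ⟨hne, hpost, hunif, hmax⟩ : Nonempty G.Secret ∧ (∀ d j, G.post d j = j) ∧
      G.IsUniform ((N : ℝ) / 2) ∧ G.MaxS T ≤ 1 / 2 + (T : ℝ) ^ 2 / N := by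
    rcases hG with rfl | rfl
    · exact ⟨⟨((0, 0, 0, false) : ZMod N × ZMod N × ZMod N × Bool)⟩, fun _ _ => rfl,
        ddhGame_isUniform N, ddhGame_MaxS_le N T⟩
    · exact ⟨⟨((0, 0, false) : ZMod N × ZMod N × Bool)⟩, fun _ _ => rfl,
        sqddhGame_isUniform N, sqddhGame_MaxS_le N T⟩
  refine ⟨hunif, fun A => ?_, ?_⟩
  -- The summand T²/N is slack here.
  · exact (PCGame.preprocSuccess_le hpost hunif A).trans (le_add_of_nonneg_right (by positivity))
  · rw [mul_div_assoc 2 ((T : ℝ) ^ 2)]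
    linarith
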